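/- An $\ell$-graph is an $\ell$-uniform hypergraph without repeated edges; $v(\cdot)$ and $e(\cdot)$ denote its numbers of vertices and edges. Let $H$ be a finite $\ell$-graph with $e(H)\ge 2$. Put $$m(H)=\max_{H'\subset H,\ e(H')>1}\frac{e(H')-1}{v(H')-\ell},$$ the maximum being over all subgraphs $H'$ of $H$ with at least two edges. A copy of $H$ in an $\ell$-graph $G$ is a subgraph of $G$ isomorphic to $H$, and $G$ is $H$-free if it contains no copy of $H$. Let $\mathrm{ex}(N,H)$ be the maximum number of edges of an $H$-free $\ell$-graph on $N$ vertices, and let $\pi(H)=\lim_{N\to\infty}\mathrm{ex}(N,H)\binom{N}{\ell}^{-1}$. For $\ell$-graphs $G,G'$ on the vertex set $[N]=\{1,\dots,N\}$ write $G\subset G'$ if every edge of $G$ is an edge of $G'$. **Theorem.** Let $H$ be an $\ell$-graph with $e(H)\ge2$ and let $\varepsilon>0$. There exist $c>0$ and $N_0$ such that for every $N\ge N_0$ there exist a collection $\mathcal C$ of $\ell$-graphs on vertex set $[N]$ and a function $T\mapsto C(T)$, assigning an $\ell$-graph on $[N]$ to each finite tuple $T$ of $\ell$-graphs on $[N]$,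 with the following properties. (a) For every $H$-free $\ell$-graph $I$ on $[N]$ there is some $C\in\mathcal C$ with $I\subset C$. (b) Moreover, $C$ in (a) can be chosen so that $C=C(T)$ for some tuple $T=(T_1,\dots,T_s)$ with $T_i\subset I$ for each $i$, $s\le c$, and $\sum_{i} e(T_i)\le c\,N^{\ell-1/m(H)}$. (c) For every $C\in\mathcal C$, the number of copies of $H$ in $C$ is at most $\varepsilon N^{v(H)}$, and $e(C)\le(\pi(H)+\varepsilon)\binom N\ell$. (d) $\log|\mathcal C|\le c\,N^{\ell-1/m(H)}\log N$. -/

import Mathlib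

/-- An `ℓ`-graph (`ℓ`-uniform hypergraph without repeated edges) whose vertex set is the type `V`. -/
@[ext]
structure LGraph (ℓ : ℕ) (V : Type*) where
  /-- the edges: `ℓ`-element sets of vertices -/
  edges : Finset (Finset V)
  uniform : ∀ e ∈ edges, e.card = ℓ

namespace LGraph

/-- A subgraph of `G`: a set of vertices and a set of edges of `G` lying inside it. -/
@[ext]
structure Subgraph {ℓ : ℕ} {V : Type*} (G : LGraph ℓ V) where
  verts : Finset V
  edges : Finset (Finset V)
  edges_subset : edges ⊆ G.edges
  subset_verts : ∀ e ∈ edges, e ⊆ verts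

/-- The subgraph `S` of `G` is isomorphic to `H` (a "copy of `H`"): some bijection from the vertices
of `H` onto the vertices of `S` carries the edge set of `H` onto the edge set of `S`. -/
def Subgraph.IsCopy {ℓ : ℕ} {V W : Type*} [Fintype V] {G : LGraph ℓ W} (S : G.Subgraph)
    (H : LGraph ℓ V) : Prop :=
  ∃ f : V ↪ W, S.verts = Finset.univ.map f ∧
    S.edges = H.edges.map (Finset.mapEmbedding f).toEmbedding

/-- The number of copies of `H` in `G`, i.e. of subgraphs of `G` isomorphic to `H`. -/
noncomputable def copies {ℓ : ℕ} {V W : Type*} [Fintype V] (H : LGraph ℓ V) (G : LGraph ℓ W) : ℕ :=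
  Set.ncard {S : G.Subgraph | S.IsCopy H}

/-- `G` is `H`-free: no subgraph of `G` is isomorphic to `H`. -/
def Free {ℓ : ℕ} {V W : Type*} [Fintype V] (H : LGraph ℓ V) (G : LGraph ℓ W) : Prop :=
  ∀ S : G.Subgraph, ¬ S.IsCopy H

/-- `m(H) = max (e(H') - 1) / (v(H') - ℓ)`, over the subgraphs `H'` of `H` with `e(H') > 1`. -/
noncomputable def mParam {ℓ : ℕ} {V : Type*} (H : LGraph ℓ V) : ℝ :=
  sSup {x : ℝ | ∃ S : H.Subgraph, 1 < S.edges.card ∧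
    x = ((S.edges.card : ℝ) - 1) / ((S.verts.card : ℝ) - (ℓ : ℝ))}

/-- `ex(N, H)`: the maximum number of edges of an `H`-free `ℓ`-graph on `N` vertices. -/
noncomputable def extremalNumber {ℓ : ℕ} {V : Type*} [Fintype V] (N : ℕ) (H : LGraph ℓ V) : ℕ :=
  sSup {k : ℕ | ∃ G : LGraph ℓ (Fin N), Free H G ∧ k = G.edges.card}

/-- The Turán density `π(H) = lim ex(N, H) / (N choose ℓ)`; the limit exists by
`LGraph.tendsto_turanDensity`. -/
noncomputable def turanDensity {ℓ : ℕ} {V : Type*} [Fintype V] (H : LGraph ℓ V) : ℝ :=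
  Filter.limUnder Filter.atTop fun N : ℕ => (extremalNumber N H : ℝ) / (N.choose ℓ : ℝ)

/-! The remaining facts show that the maximum and the limit above are genuine. -/

theorem Subgraph.finite {ℓ : ℕ} {V : Type*} [Finite V] (H : LGraph ℓ V) : Finite H.Subgraph := by
  have := Fintype.ofFinite V
  refine Finite.of_injective
    (fun S : H.Subgraph => ((S.verts, S.edges) : Finset V × Finset (Finset V))) ?_
  intro S T h
  simp only [Prod.mk.injEq] at h
  exact Subgraph.ext h.1 h.2

/-- The maximum in the definition of `m(H)` is attained when `e(H) ≥ 2`. -/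
theorem isGreatest_mParam {ℓ : ℕ} {V : Type*} [Fintype V] (H : LGraph ℓ V)
    (hH : 2 ≤ H.edges.card) :
    IsGreatest {x : ℝ | ∃ S : H.Subgraph, 1 < S.edges.card ∧
      x = ((S.edges.card : ℝ) - 1) / ((S.verts.card : ℝ) - (ℓ : ℝ))} H.mParam := by
  have := Subgraph.finite H
  have hfin : Set.Finite {x : ℝ | ∃ S : H.Subgraph, 1 < S.edges.card ∧
      x = ((S.edges.card : ℝ) - 1) / ((S.verts.card : ℝ) - (ℓ : ℝ))} := by
    refine (Set.finite_range fun S : H.Subgraph =>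
      ((S.edges.card : ℝ) - 1) / ((S.verts.card : ℝ) - (ℓ : ℝ))).subset ?_
    rintro x ⟨S, -, rfl⟩
    exact ⟨S, rfl⟩
  have hne : Set.Nonempty {x : ℝ | ∃ S : H.Subgraph, 1 < S.edges.card ∧
      x = ((S.edges.card : ℝ) - 1) / ((S.verts.card : ℝ) - (ℓ : ℝ))} :=
    ⟨_, ⟨Finset.univ, H.edges, subset_rfl, fun e _ => Finset.subset_univ e⟩, hH, rfl⟩
  exact ⟨hne.csSup_mem hfin, fun x hx => le_csSup hfin.bddAbove hx⟩

/-- The denominators `v(H') - ℓ` in the definition of `m(H)` are positive. -/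
theorem Subgraph.lt_card_verts {ℓ : ℕ} {V : Type*} {H : LGraph ℓ V} (S : H.Subgraph)
    (hS : 1 < S.edges.card) : ℓ < S.verts.card := by
  obtain ⟨a, ha, b, hb, hab⟩ := Finset.one_lt_card.1 hS
  have hca := H.uniform a (S.edges_subset ha)
  have hcb := H.uniform b (S.edges_subset hb)
  by_contra hlt
  have h1 := Finset.eq_of_subset_of_card_le (S.subset_verts a ha) (by omega)
  have h2 := Finset.eq_of_subset_of_card_le (S.subset_verts b hb) (by omega)
  exact hab (h1.trans h2.symm)

theorem card_edges_le {ℓ N : ℕ} (G : LGraph ℓ (Fin N)) : G.edges.card ≤ N.choose ℓ := by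
  have : G.edges ⊆ Finset.powersetCard ℓ Finset.univ := fun e he =>
    Finset.mem_powersetCard.2 ⟨Finset.subset_univ e, G.uniform e he⟩
  simpa using Finset.card_le_card this

theorem bddAbove_free {ℓ : ℕ} {V : Type*} [Fintype V] (N : ℕ) (H : LGraph ℓ V) :
    BddAbove {k : ℕ | ∃ G : LGraph ℓ (Fin N), Free H G ∧ k = G.edges.card} :=
  ⟨N.choose ℓ, by rintro k ⟨G, -, rfl⟩; exact G.card_edges_le⟩

/-- Averaging over the deletion of one vertex. -/
theorem extremalNumber_succ_mul_le {ℓ : ℕ} {V : Type*} [Fintype V] (N : ℕ) (H : LGraph ℓ V) :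
    extremalNumber (N + 1) H * (N + 1 - ℓ) ≤ extremalNumber N H * (N + 1) := by
  rcases Set.eq_empty_or_nonempty
    {k : ℕ | ∃ G : LGraph ℓ (Fin (N + 1)), Free H G ∧ k = G.edges.card} with h0 | h0
  · simp [extremalNumber, h0]
  obtain ⟨G, hG, hk⟩ := Nat.sSup_mem h0 (bddAbove_free (N + 1) H)
  have hk' : extremalNumber (N + 1) H = G.edges.card := hk
  have key : ∀ v : Fin (N + 1), (G.edges.filter fun e => v ∉ e).card ≤ extremalNumber N H := by
    intro v
    let f : Fin N ↪ Fin (N + 1) := Fin.succAboveEmb v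
    let φ : Finset (Fin N) ↪ Finset (Fin (N + 1)) := (Finset.mapEmbedding f).toEmbedding
    let G' : LGraph ℓ (Fin N) :=
      ⟨Finset.univ.filter fun e => e.map f ∈ G.edges, fun e he => by
        rw [← Finset.card_map f]
        exact G.uniform _ (Finset.mem_filter.1 he).2⟩
    have hmap : ∀ e ∈ G'.edges, e.map f ∈ G.edges := fun e he => (Finset.mem_filter.1 he).2
    have hfree : Free H G' := by
      rintro S ⟨g, hv, he⟩
      refine hG ⟨S.verts.map f, S.edges.map φ, ?_, ?_⟩ ⟨g.trans f, ?_, ?_⟩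
      · intro e he
        obtain ⟨e', he', rfl⟩ := Finset.mem_map.1 he
        exact hmap e' (S.edges_subset he')
      · intro e he
        obtain ⟨e', he', rfl⟩ := Finset.mem_map.1 he
        exact Finset.map_subset_map.2 (S.subset_verts e' he')
      · simp only [hv, Finset.map_map]
      · simp only [he, Finset.map_map]
        congr 1
        ext e : 1
        simp [φ, Finset.map_map]
    have hsub : (G.edges.filter fun e => v ∉ e) ⊆ G'.edges.map φ := by
      intro e he
      obtain ⟨he, hve⟩ := Finset.mem_filter.1 he
      have hr : (e : Set (Fin (N + 1))) ⊆ Set.range f := by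
        intro x hx
        have : x ≠ v := fun h => hve (h ▸ hx)
        obtain ⟨y, hy⟩ := Fin.exists_succAbove_eq this
        exact ⟨y, hy⟩
      have hm : (e.preimage f f.injective.injOn).map f = e := by
        rw [Finset.map_eq_image, Finset.image_preimage]
        exact Finset.filter_true_of_mem fun x hx => hr hx
      refine Finset.mem_map.2 ⟨e.preimage f f.injective.injOn, ?_, hm⟩
      exact Finset.mem_filter.2 ⟨Finset.mem_univ _, by rw [hm]; exact he⟩
    calc _ ≤ (G'.edges.map φ).card := Finset.card_le_card hsub
      _ = G'.edges.card := Finset.card_map _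
      _ ≤ _ := le_csSup (bddAbove_free N H) ⟨G', hfree, rfl⟩
  rw [hk']
  calc G.edges.card * (N + 1 - ℓ)
      = ∑ e ∈ G.edges, (Finset.univ.filter fun v => v ∉ e).card := by
        rw [← smul_eq_mul, ← Finset.sum_const]
        refine Finset.sum_congr rfl fun e he => ?_
        have : (Finset.univ.filter fun v => v ∉ e) = eᶜ := by ext; simp
        rw [this, Finset.card_compl, Fintype.card_fin, G.uniform e he]
    _ = ∑ v : Fin (N + 1), (G.edges.filter fun e => v ∉ e).card :=
        (Finset.sum_card_bipartiteAbove_eq_sum_card_bipartiteBelow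
          (fun (v : Fin (N + 1)) (e : Finset (Fin (N + 1))) => v ∉ e)).symm
    _ ≤ ∑ _v : Fin (N + 1), extremalNumber N H := Finset.sum_le_sum fun v _ => key v
    _ = extremalNumber N H * (N + 1) := by simp [mul_comm]

/-- The limit defining `π(H)` exists. -/
theorem tendsto_turanDensity {ℓ : ℕ} {V : Type*} [Fintype V] (H : LGraph ℓ V) :
    Filter.Tendsto (fun N : ℕ => (extremalNumber N H : ℝ) / (N.choose ℓ : ℝ)) Filter.atTop
      (nhds H.turanDensity) := by
  have hanti : AntitoneOn (fun N : ℕ => (extremalNumber N H : ℝ) / (N.choose ℓ : ℝ))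
      (Set.Ici ℓ) := by
    apply antitoneOn_nat_Ici_of_succ_le
    intro N hN
    have h1 : 0 < N.choose ℓ := Nat.choose_pos hN
    have h2 : 0 < (N + 1).choose ℓ := Nat.choose_pos (by omega)
    have h3 : 0 < N + 1 - ℓ := by omega
    rw [div_le_div_iff₀ (by exact_mod_cast h2) (by exact_mod_cast h1)]
    have h := extremalNumber_succ_mul_le N H
    have hc := Nat.choose_mul_succ_eq N ℓ
    have : extremalNumber (N + 1) H * N.choose ℓ ≤ extremalNumber N H * (N + 1).choose ℓ := by
      refine Nat.le_of_mul_le_mul_right ?_ h3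
      calc extremalNumber (N + 1) H * N.choose ℓ * (N + 1 - ℓ)
          = (extremalNumber (N + 1) H * (N + 1 - ℓ)) * N.choose ℓ := by ring
        _ ≤ (extremalNumber N H * (N + 1)) * N.choose ℓ := Nat.mul_le_mul_right _ h
        _ = extremalNumber N H * (N.choose ℓ * (N + 1)) := by ring
        _ = extremalNumber N H * (N + 1).choose ℓ * (N + 1 - ℓ) := by rw [hc]; ring
    exact_mod_cast this
  have hb : BddBelow {((extremalNumber N H : ℝ) / (N.choose ℓ : ℝ)) | N ∈ Set.Ici ℓ} := by
    refine ⟨0, fun x ⟨_, _, hx⟩ => ?_⟩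
    rw [← hx]
    positivity
  have ht := Real.tendsto_atTop_csInf_of_antitoneOn_bddBelow_nat_Ici hanti hb
  rwa [turanDensity, ht.limUnder_eq]

end LGraph

/-! Take the hypergraph whose vertices are the `ℓ`-subsets of `[N]` and whose edges are the edge
sets of copies of `H`, weighted by embeddings. An `H`-free graph is an independent set in it. Put `p
= N ^ (-1/m(H))` and `M = N ^ ℓ`, so that `p * M` is the required fingerprint size. By definition of
`m(H)`, any `j ≥ 1` edges of `H` span at least `ℓ + (j-1)/m(H)` vertices. Hence `j` given `ℓ`-sets
lie together in only `O(p^(j-1) * N^(v(H)-ℓ))` embeddings (`deg_copyWeight_le`). On a family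
carrying more than `δ * N^v(H)` embeddings this is the condition `Spread`.

`exists_container` treats one spread weight `w` by induction on the uniformity. Repeatedly pick from
`I` a vertex heavy in the surviving part of `w`, and add its link to a weight `w'` of uniformity one
less. An edge of `w` survives while it contains no set whose `w'`-degree has reached a threshold,
which keeps `w'` spread. The picked vertices lie in `I`, so `I` is also independent in `w'`. After
about `p * M` rounds `w'` either has enough total weight for the induction hypothesis, or the run
stopped early. In the latter case `I` avoids all heavy vertices; these number at least a constant
times `M` and can be discarded. The picked vertices alone reproduce the run (`greedy_congr`), so the
container is a function of the fingerprint.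

Each application removes a constant proportion of `M`, so boundedly many leave at most `δ * N^v(H)`
embeddings (`exists_iterated_container`). Averaging over vertex sets of fixed size then bounds the
number of edges (`supersaturation`), and counting possible fingerprints bounds the number of
containers. -/

namespace HypergraphContainer

open Finset

/-! ### Greedy selection of a fingerprint. -/

section Greedy

variable {U σ : Type*} [Fintype U] [DecidableEq U]

/-- The first element of `S` in a fixed enumeration of the ambient type. -/
noncomputable def first (S : Finset U) : Option U :=
  (Finset.univ : Finset U).toList.find? fun v => decide (v ∈ S)

theorem mem_of_first_eq_some {S : Finset U} {v : U} (h : first S = some v) : v ∈ S := by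
  simpa using List.find?_some h

theorem first_eq_none_iff {S : Finset U} : first S = none ↔ S = ∅ := by
  simp [first, Finset.eq_empty_iff_forall_notMem]

theorem find?_eq_some_of_imp {α : Type*} {p q : α → Bool} {v : α} (hqp : ∀ x, q x → p x)
    (hv : q v) : ∀ l : List α, l.find? p = some v → l.find? q = some v
  | [], h => by simp at h
  | a :: l, h => by
    by_cases hp : p a
    · rw [List.find?_cons_of_pos hp] at h
      obtain rfl : a = v := by simpa using h
      rw [List.find?_cons_of_pos hv]
    · rw [List.find?_cons_of_neg hp] at h
      rw [List.find?_cons_of_neg (fun hq => hp (hqp a hq))]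
      exact find?_eq_some_of_imp hqp hv l h

theorem first_eq_some_of_subset {S S' : Finset U} {v : U} (hS : S' ⊆ S) (h : first S = some v)
    (hv : v ∈ S') : first S' = some v :=
  find?_eq_some_of_imp (fun x hx => by simpa using hS (by simpa using hx)) (by simpa using hv) _ h

variable (P : σ → Finset U) (step : σ → U → σ)

/-- At most `n` times, take the first vertex of `I` which is eligible in the current state, and
update the state. The result is the final state and the set of vertices taken. -/
noncomputable def greedy : ℕ → σ → Finset U → σ × Finset U
  | 0, s, _ => (s, ∅)
  | n + 1, s, I =>
    match first (P s ∩ I) with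
    | none => (s, ∅)
    | some v => ((greedy n (step s v) I).1, insert v (greedy n (step s v) I).2)

theorem greedy_succ_of_none {n : ℕ} {s : σ} {I : Finset U} (h : first (P s ∩ I) = none) :
    greedy P step (n + 1) s I = (s, ∅) := by
  rw [greedy, h]

theorem greedy_succ_of_some {n : ℕ} {s : σ} {I : Finset U} {v : U}
    (h : first (P s ∩ I) = some v) :
    greedy P step (n + 1) s I =
      ((greedy P step n (step s v) I).1, insert v (greedy P step n (step s v) I).2) := by
  rw [greedy, h]

theorem greedy_snd_subset (I : Finset U) : ∀ n s, (greedy P step n s I).2 ⊆ I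
  | 0, s => by simp [greedy]
  | n + 1, s => by
    rcases h : first (P s ∩ I) with _ | v
    · simp [greedy_succ_of_none P step h]
    · rw [greedy_succ_of_some P step h]
      exact insert_subset (mem_inter.1 (mem_of_first_eq_some h)).2 (greedy_snd_subset I n _)

theorem card_greedy_snd_le (I : Finset U) : ∀ n s, (greedy P step n s I).2.card ≤ n
  | 0, s => by simp [greedy]
  | n + 1, s => by
    rcases h : first (P s ∩ I) with _ | v
    · simp [greedy_succ_of_none P step h]
    · rw [greedy_succ_of_some P step h]
      exact (card_insert_le _ _).trans (Nat.succ_le_succ (card_greedy_snd_le I n _))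

/-- The pick follows a fixed enumeration, so shrinking `I` to a set that still contains the pick
does not change it. With `J` the fingerprint itself, the run can be replayed without knowing `I`. -/
theorem greedy_congr {I J : Finset U} (hJ : J ⊆ I) :
    ∀ n s, (greedy P step n s I).2 ⊆ J → greedy P step n s J = greedy P step n s I
  | 0, s, _ => by simp [greedy]
  | n + 1, s, hF => by
    rcases h : first (P s ∩ I) with _ | v
    · have h' : first (P s ∩ J) = none := by
        rw [first_eq_none_iff] at h ⊢
        exact subset_empty.1 (h ▸ inter_subset_inter_left hJ)
      rw [greedy_succ_of_none P step h, greedy_succ_of_none P step h']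
    · rw [greedy_succ_of_some P step h] at hF ⊢
      have hF' := insert_subset_iff.1 hF
      have h' : first (P s ∩ J) = some v :=
        first_eq_some_of_subset (inter_subset_inter_left hJ) h
          (mem_inter.2 ⟨(mem_inter.1 (mem_of_first_eq_some h)).1, hF'.1⟩)
      rw [greedy_succ_of_some P step h', greedy_congr hJ n _ hF'.2]

theorem greedy_invariant {I : Finset U} {Q : ℕ → σ → Prop}
    (hQ : ∀ j s v, Q j s → v ∈ P s → v ∈ I → Q (j + 1) (step s v)) :
    ∀ n j s, Q j s → ∃ i ≤ n, Q (j + i) (greedy P step n s I).1 ∧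
      (i = n ∨ P (greedy P step n s I).1 ∩ I = ∅)
  | 0, j, s, h => ⟨0, le_rfl, by simpa [greedy] using h, Or.inl rfl⟩
  | n + 1, j, s, h => by
    rcases hv : first (P s ∩ I) with _ | v
    · rw [greedy_succ_of_none P step hv]
      exact ⟨0, Nat.zero_le _, h, Or.inr (first_eq_none_iff.1 hv)⟩
    · rw [greedy_succ_of_some P step hv]
      have hm := mem_inter.1 (mem_of_first_eq_some hv)
      obtain ⟨i, hi, hq, hs⟩ := greedy_invariant hQ n (j + 1) _ (hQ j s v h hm.1 hm.2)
      refine ⟨i + 1, by omega, ?_, hs.imp (by omega) id⟩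
      rwa [add_assoc, add_comm 1 i] at hq

end Greedy

/-! ### Weighted hypergraphs, degrees, links and saturation. -/

section Weights

variable {U : Type*} [Fintype U] [DecidableEq U]

/-- The degree of `T` in the weighted hypergraph `w`. -/
def deg (w : Finset U → ℝ) (T : Finset U) : ℝ := ∑ e with T ⊆ e, w e

theorem deg_empty (w : Finset U → ℝ) : deg w ∅ = ∑ e, w e := by simp [deg]

theorem deg_nonneg {w : Finset U → ℝ} (hw : ∀ e, 0 ≤ w e) (T : Finset U) : 0 ≤ deg w T :=
  sum_nonneg fun _ _ => hw _

theorem deg_mono {w w' : Finset U → ℝ} (h : ∀ e, w e ≤ w' e) (T : Finset U) :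
    deg w T ≤ deg w' T :=
  sum_le_sum fun _ _ => h _

theorem exists_of_deg_ne_zero {w : Finset U → ℝ} {T : Finset U} (h : deg w T ≠ 0) :
    ∃ e, T ⊆ e ∧ w e ≠ 0 := by
  obtain ⟨e, he, hne⟩ := exists_ne_zero_of_sum_ne_zero h
  exact ⟨e, by simpa using he, hne⟩

/-- The link of a vertex in a weighted hypergraph. -/
def link (w : Finset U → ℝ) (v : U) (A : Finset U) : ℝ := if v ∈ A then 0 else w (insert v A)

theorem deg_link_of_mem (w : Finset U → ℝ) {v : U} {T : Finset U} (h : v ∈ T) :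
    deg (link w v) T = 0 :=
  sum_eq_zero fun _ he => if_pos ((mem_filter.1 he).2 h)

theorem deg_link_of_notMem (w : Finset U → ℝ) {v : U} {T : Finset U} (h : v ∉ T) :
    deg (link w v) T = deg w (insert v T) := by
  simp only [deg, link, sum_ite, sum_const_zero, zero_add, filter_filter]
  refine sum_nbij' (fun A => insert v A) (fun e => e.erase v) ?_ ?_ ?_ ?_ ?_
  · intro A hA
    simp only [mem_filter, mem_univ, true_and] at hA ⊢
    exact insert_subset_insert v hA.1
  · intro e he
    simp only [mem_filter, mem_univ, true_and] at he ⊢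
    exact ⟨(subset_erase).2 ⟨(subset_insert v T).trans he, h⟩, notMem_erase v e⟩
  · intro A hA
    simp only [mem_filter, mem_univ, true_and] at hA
    exact erase_insert hA.2
  · intro e he
    simp only [mem_filter, mem_univ, true_and] at he
    exact insert_erase (he (mem_insert_self v T))
  · intro A _
    rfl

theorem deg_add (w w' : Finset U → ℝ) (T : Finset U) :
    deg (fun e => w e + w' e) T = deg w T + deg w' T :=
  sum_add_distrib

theorem sum_deg {w : Finset U → ℝ} {r : ℕ} (hw : ∀ e, w e ≠ 0 → e.card = r) :
    ∑ T, deg w T = 2 ^ r * deg w ∅ := by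
  simp only [deg, sum_filter]
  rw [sum_comm]
  simp only [empty_subset, if_true, mul_sum]
  refine sum_congr rfl fun e _ => ?_
  rw [← sum_filter, sum_const, nsmul_eq_mul]
  have : (univ.filter fun T => T ⊆ e) = e.powerset := by ext; simp
  rw [this, card_powerset]
  by_cases h : w e = 0
  · simp [h]
  · rw [hw e h]; push_cast; rfl

theorem sum_deg_singleton {w : Finset U → ℝ} {r : ℕ} (hw : ∀ e, w e ≠ 0 → e.card = r) :
    ∑ v, deg w {v} = r * deg w ∅ := by
  simp only [deg, sum_filter]
  rw [sum_comm]
  simp only [empty_subset, if_true, mul_sum, singleton_subset_iff]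
  refine sum_congr rfl fun e _ => ?_
  rw [← sum_filter, sum_const, nsmul_eq_mul]
  by_cases h : w e = 0
  · simp [h]
  · simp [hw e h]

/-- The weighted hypergraph `w` is `r`-uniform, lives on `X`, and its degrees are spread out as in
the hypotheses of the container theorem. -/
structure Spread (r : ℕ) (X : Finset U) (K p M : ℝ) (w : Finset U → ℝ) : Prop where
  nonneg : ∀ e, 0 ≤ w e
  card_eq : ∀ e, w e ≠ 0 → e.card = r
  subset : ∀ e, w e ≠ 0 → e ⊆ X
  pos : 0 < deg w ∅
  deg_le : ∀ T, T.Nonempty → p * deg w T ≤ K * p ^ T.card * (deg w ∅ / M)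

/-- `I` contains no edge of `w`. -/
def Indep (w : Finset U → ℝ) (I : Finset U) : Prop := ∀ e, w e ≠ 0 → ¬ e ⊆ I

open Classical in
/-- The edges of `w` that contain no set whose degree in `w'` has reached its threshold. -/
noncomputable def alive (κ : Finset U → ℝ) (w w' : Finset U → ℝ) (e : Finset U) : ℝ :=
  if ∃ T ⊆ e, T.Nonempty ∧ κ T ≤ deg w' T then 0 else w e

theorem alive_le {κ w w' : Finset U → ℝ} (hw : ∀ e, 0 ≤ w e) (e : Finset U) :
    alive κ w w' e ≤ w e := by
  unfold alive; split_ifs; exacts [hw e, le_rfl]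

theorem alive_nonneg {κ w w' : Finset U → ℝ} (hw : ∀ e, 0 ≤ w e) (e : Finset U) :
    0 ≤ alive κ w w' e := by
  unfold alive; split_ifs; exacts [le_rfl, hw e]

theorem alive_ne_zero {κ w w' : Finset U → ℝ} {e : Finset U} (h : alive κ w w' e ≠ 0) :
    w e ≠ 0 := by
  unfold alive at h; split_ifs at h; exacts [absurd rfl h, h]

theorem deg_alive_of_saturated {κ w w' : Finset U → ℝ} {T S : Finset U} (hT : T.Nonempty)
    (hκ : κ T ≤ deg w' T) (hTS : T ⊆ S) : deg (alive κ w w') S = 0 :=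
  sum_eq_zero fun _ he => if_pos ⟨T, hTS.trans (mem_filter.1 he).2, hT, hκ⟩

-- Union bound: each edge lost contains some saturated nonempty set, and is counted in the degree of
-- that set.
open Classical in
theorem deg_empty_sub_alive_le {κ w w' : Finset U → ℝ} (hw : ∀ e, 0 ≤ w e) :
    deg w ∅ - deg (alive κ w w') ∅ ≤
      ∑ T with T.Nonempty ∧ κ T ≤ deg w' T, deg w T := by
  have hswap : ∑ T with T.Nonempty ∧ κ T ≤ deg w' T, deg w T =
      ∑ e, ∑ T with T.Nonempty ∧ κ T ≤ deg w' T, if T ⊆ e then w e else 0 := by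
    rw [sum_comm]
    exact sum_congr rfl fun T _ => sum_filter _ _
  rw [deg_empty, deg_empty, ← sum_sub_distrib, hswap]
  refine sum_le_sum fun e _ => ?_
  have h0 : ∀ T ∈ univ.filter (fun T : Finset U => T.Nonempty ∧ κ T ≤ deg w' T),
      0 ≤ if T ⊆ e then w e else 0 := fun T _ => by split_ifs; exacts [hw e, le_rfl]
  by_cases h : ∃ T ⊆ e, T.Nonempty ∧ κ T ≤ deg w' T
  · obtain ⟨T, hT, h1, h2⟩ := h
    have h3 := single_le_sum h0 (mem_filter.2 ⟨mem_univ T, h1, h2⟩)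
    rw [if_pos hT] at h3
    rw [alive, if_pos ⟨T, hT, h1, h2⟩, sub_zero]
    exact h3
  · rw [alive, if_neg h, sub_self]
    exact sum_nonneg h0

-- For saturated `T`, spreadness bounds `p * deg w T` by `K / L` times the threshold, hence by `K /
-- L * deg w' T`. Summing over all `T` counts each edge of `w'` once for each of its `2 ^ q`
-- subsets. A large `L` thus makes the loss small.
open Classical in
theorem alive_total_ge {r : ℕ} {X : Finset U} {K L p M : ℝ} {w w' : Finset U → ℝ}
    (hw : Spread r X K p M w) (hK : 0 < K) (hL : 0 < L) (hp : 0 < p) (hM : 0 < M) {q : ℕ}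
    (hw0 : ∀ e, 0 ≤ w' e) (hcard : ∀ e, w' e ≠ 0 → e.card = q) :
    p * (deg w ∅ - deg (alive (fun T => L * p ^ T.card * (deg w ∅ / M)) w w') ∅) ≤
      K / L * (2 ^ q * deg w' ∅) := by
  have hW := hw.pos
  refine (mul_le_mul_of_nonneg_left (deg_empty_sub_alive_le hw.nonneg) hp.le).trans ?_
  rw [← sum_deg hcard, mul_sum, mul_sum]
  refine (sum_le_sum (g := fun T => K / L * deg w' T) fun T hT => ?_).trans
    (sum_le_sum_of_subset_of_nonneg (subset_univ _) fun T _ _ =>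
      mul_nonneg (by positivity) (deg_nonneg hw0 T))
  obtain ⟨-, h1, h2⟩ := mem_filter.1 hT
  refine (hw.deg_le T h1).trans ?_
  calc K * p ^ T.card * (deg w ∅ / M)
      = K / L * (L * p ^ T.card * (deg w ∅ / M)) := by field_simp
    _ ≤ _ := mul_le_mul_of_nonneg_left h2 (by positivity)

/-- The proportion of vertices that a container for an `r`-uniform hypergraph omits. -/
noncomputable def gain : ℕ → ℝ → ℝ
  | 0, _ => 1
  | r + 1, K => min (1 / (4 * K)) (gain r (4 * (4 * 2 ^ r * K ^ 2 + K)))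

theorem gain_pos : ∀ (r : ℕ) {K : ℝ}, 0 < K → 0 < gain r K
  | 0, _, _ => one_pos
  | r + 1, K, hK => lt_min (by positivity) (gain_pos r (by positivity))

end Weights

end HypergraphContainer

namespace HypergraphContainer

open Finset

/-! ### The container theorem and its iteration. -/

section Step

variable {U : Type*} [Fintype U] [DecidableEq U]

/-- The part of `w` still in use once the hypergraph `w'` of lower uniformity has been built. -/
noncomputable def current (L p M : ℝ) (w w' : Finset U → ℝ) : Finset U → ℝ :=
  alive (fun T => L * p ^ T.card * (deg w ∅ / M)) w w'

open Classical in
/-- The vertices of large degree in the part of `w` still in use. -/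
noncomputable def heavy (L p M : ℝ) (w w' : Finset U → ℝ) : Finset U :=
  {v | deg w ∅ / M / 4 ≤ deg (current L p M w w') {v}}

/-- Add the link of `v` to `w'`. -/
noncomputable def addLink (L p M : ℝ) (w w' : Finset U → ℝ) (v : U) : Finset U → ℝ :=
  fun A => w' A + link (current L p M w w') v A

/-- What is known of the hypergraph `w'` after `j` links have been added. -/
structure Inv (r : ℕ) (X I : Finset U) (K L p M : ℝ) (w : Finset U → ℝ) (j : ℕ)
    (w' : Finset U → ℝ) : Prop where
  nonneg : ∀ e, 0 ≤ w' e
  card_eq : ∀ e, w' e ≠ 0 → e.card = r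
  subset : ∀ e, w' e ≠ 0 → e ⊆ X
  indep : Indep w' I
  deg_le : ∀ T, T.Nonempty → deg w' T ≤ (L + K) * p ^ T.card * (deg w ∅ / M)
  total_ge : j * (deg w ∅ / M / 4) ≤ deg w' ∅
  total_le : deg w' ∅ ≤ j * (K * (deg w ∅ / M))

variable {r : ℕ} {X I : Finset U} {K L p M : ℝ} {w : Finset U → ℝ}

theorem deg_current_le (hw : Spread r X K p M w) (w' : Finset U → ℝ) (T : Finset U) :
    deg (current L p M w w') T ≤ deg w T :=
  deg_mono (alive_le hw.nonneg) T

theorem inv_zero (hw : Spread (r + 1) X K p M w) (hK : 0 < K) (hL : 0 < L) (hp : 0 < p)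
    (hM : 0 < M) : Inv r X I K L p M w 0 (fun _ => 0) where
  nonneg _ := le_rfl
  card_eq _ h := absurd rfl h
  subset _ h := absurd rfl h
  indep _ h := absurd rfl h
  deg_le T _ := by
    have := hw.pos
    simp only [deg, sum_const_zero]
    positivity
  total_ge := by simp [deg]
  total_le := by simp [deg]

/-- An edge of the link together with `v` is an edge of `w`, so `v ∈ I` transfers independence to
the link. Heaviness of `v` gives the lower bound on the gain in total weight, spreadness of `w` the
upper bound. -/
theorem Inv.step (hw : Spread (r + 1) X K p M w) (hI : Indep w I)
    (hp : 0 < p) (hM : 0 < M) {j : ℕ} {w' : Finset U → ℝ} {v : U}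
    (h : Inv r X I K L p M w j w') (hv : v ∈ heavy L p M w w') (hvI : v ∈ I) :
    Inv r X I K L p M w (j + 1) (addLink L p M w w' v) := by
  have hW := hw.pos
  have hpos : 0 < deg w ∅ / M := by positivity
  have hlink : ∀ e, link (current L p M w w') v e ≠ 0 → v ∉ e ∧ w (insert v e) ≠ 0 := by
    intro e he
    unfold link at he
    split_ifs at he with hve
    · exact absurd rfl he
    · exact ⟨hve, alive_ne_zero he⟩
  have hsplit : ∀ e, addLink L p M w w' v e ≠ 0 →
      w' e ≠ 0 ∨ v ∉ e ∧ w (insert v e) ≠ 0 := by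
    intro e he
    by_contra hcon
    push Not at hcon
    refine he ?_
    have h2 : link (current L p M w w') v e = 0 := by
      by_contra h2
      exact (hlink e h2).2 (hcon.2 (hlink e h2).1)
    rw [addLink, hcon.1, h2, add_zero]
  have hdeg : ∀ T, deg (addLink L p M w w' v) T =
      deg w' T + deg (link (current L p M w w') v) T := fun T => deg_add _ _ T
  have hadd : ∀ T, v ∉ T → deg (link (current L p M w w') v) T ≤
      K * p ^ T.card * (deg w ∅ / M) := by
    intro T hvT
    rw [deg_link_of_notMem _ hvT]
    refine (deg_current_le hw _ _).trans (le_of_mul_le_mul_left ?_ hp)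
    refine (hw.deg_le _ (insert_nonempty v T)).trans_eq ?_
    rw [card_insert_of_notMem hvT, pow_succ]
    ring
  constructor
  · intro e
    refine add_nonneg (h.nonneg e) ?_
    unfold link
    split_ifs
    exacts [le_rfl, alive_nonneg hw.nonneg _]
  · intro e he
    rcases hsplit e he with h1 | ⟨h1, h2⟩
    · exact h.card_eq e h1
    · have := hw.card_eq _ h2
      rw [card_insert_of_notMem h1] at this
      omega
  · intro e he
    rcases hsplit e he with h1 | ⟨h1, h2⟩
    · exact h.subset e h1
    · exact (subset_insert v e).trans (hw.subset _ h2)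
  · intro e he heI
    rcases hsplit e he with h1 | ⟨h1, h2⟩
    · exact h.indep e h1 heI
    · exact hI _ h2 (insert_subset hvI heI)
  · intro T hT
    rw [hdeg]
    by_cases hvT : v ∈ T
    · rw [deg_link_of_mem _ hvT, add_zero]
      exact h.deg_le T hT
    -- Once `T` is saturated, no surviving edge contains it and its degree stays put. Before that,
    -- the degree is below the `L` threshold and one link adds at most the `K` term.
    · by_cases hsat : L * p ^ T.card * (deg w ∅ / M) ≤ deg w' T
      · rw [deg_link_of_notMem _ hvT, current, deg_alive_of_saturated hT hsat (subset_insert v T),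
          add_zero]
        exact h.deg_le T hT
      · have := hadd T hvT
        linarith
  · rw [hdeg, deg_link_of_notMem _ (notMem_empty v)]
    have h1 := h.total_ge
    have h2 : deg w ∅ / M / 4 ≤ deg (current L p M w w') {v} := (mem_filter.1 hv).2
    have h3 : insert v (∅ : Finset U) = {v} := rfl
    rw [h3]
    push_cast
    linarith
  · rw [hdeg]
    have h1 := h.total_le
    have h2 := hadd ∅ (notMem_empty v)
    rw [card_empty, pow_zero, mul_one] at h2
    push_cast
    linarith

/-- If few links were added, the heavy vertices are many. -/
theorem le_card_heavy (hw : Spread (r + 1) X K p M w) (hK : 0 < K) (hp : 0 < p) (hM : 0 < M)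
    (hX : (X.card : ℝ) ≤ M) {j : ℕ} (hj : (j : ℝ) ≤ 2 * (p * M)) {w' : Finset U → ℝ}
    (h : Inv r X I K (4 * 2 ^ r * K ^ 2) p M w j w') :
    heavy (4 * 2 ^ r * K ^ 2) p M w w' ⊆ X ∧
      1 / (4 * K) * M ≤ (heavy (4 * 2 ^ r * K ^ 2) p M w w').card := by
  set L := 4 * 2 ^ r * K ^ 2 with hLdef
  have hL : 0 < L := by positivity
  have hW := hw.pos
  set G := current L p M w w' with hG
  have hGne : ∀ e, G e ≠ 0 → w e ≠ 0 := fun e he => alive_ne_zero he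
  have hG0 : ∀ e, 0 ≤ G e := fun e => alive_nonneg hw.nonneg e
  have hheavyX : heavy L p M w w' ⊆ X := by
    intro v hv
    have h2 : deg w ∅ / M / 4 ≤ deg G {v} := (mem_filter.1 hv).2
    have h3 : deg G {v} ≠ 0 := (lt_of_lt_of_le (by positivity) h2).ne'
    obtain ⟨e, hve, he⟩ := exists_of_deg_ne_zero h3
    exact hw.subset e (hGne e he) (hve (mem_singleton_self v))
  refine ⟨hheavyX, ?_⟩
  have htot : deg w ∅ / 2 ≤ deg G ∅ := by
    have h1 := alive_total_ge hw hK hL hp hM h.nonneg h.card_eq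
    -- The value `L = 4 * 2 ^ r * K ^ 2` is chosen so that, after at most `2 * p * M` links, at most
    -- half of `w` has been lost.
    have h2 : K / L * (2 ^ r * deg w' ∅) ≤ p * (deg w ∅ / 2) := by
      calc K / L * (2 ^ r * deg w' ∅)
          ≤ K / L * (2 ^ r * (2 * (p * M) * (K * (deg w ∅ / M)))) := by
            have := h.total_le.trans (mul_le_mul_of_nonneg_right hj (by positivity))
            gcongr
        _ = _ := by rw [hLdef]; field_simp; ring
    have h3 := le_of_mul_le_mul_left (h1.trans h2) hp
    have h4 : deg G ∅ = deg (alive (fun T => L * p ^ T.card * (deg w ∅ / M)) w w') ∅ := rfl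
    linarith
  have hsum := sum_deg_singleton (w := G) (r := r + 1) fun e he => hw.card_eq e (hGne e he)
  have hupper : ∑ v, deg G {v} ≤
      ∑ v ∈ X, ((if v ∈ heavy L p M w w' then K * (deg w ∅ / M) else 0) + deg w ∅ / M / 4) := by
    rw [← sum_subset (subset_univ X) (f := fun v => deg G {v})]
    · refine sum_le_sum fun v _ => ?_
      split_ifs with hv
      · have h1 : deg G {v} ≤ K * (deg w ∅ / M) := by
          refine (deg_current_le hw w' {v}).trans (le_of_mul_le_mul_left ?_ hp)
          refine (hw.deg_le _ (singleton_nonempty v)).trans_eq ?_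
          rw [card_singleton]
          ring
        have : 0 ≤ deg w ∅ / M / 4 := by positivity
        linarith
      · have : deg G {v} < deg w ∅ / M / 4 := by
          by_contra hc
          exact hv (mem_filter.2 ⟨mem_univ v, not_lt.1 hc⟩)
        linarith
    · intro v _ hvX
      by_contra hne
      obtain ⟨e, hve, he⟩ := exists_of_deg_ne_zero hne
      exact hvX (hw.subset e (hGne e he) (hve (mem_singleton_self v)))
  rw [sum_add_distrib, ← sum_filter, sum_const, sum_const, nsmul_eq_mul, nsmul_eq_mul, hsum,
    filter_mem_eq_inter, inter_eq_right.2 hheavyX] at hupper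
  -- Light vertices account for at most a quarter of the total weight, so the heavy ones, each of
  -- degree at most `K * (deg w ∅ / M)`, carry at least another quarter.
  have h5 : (X.card : ℝ) * (deg w ∅ / M / 4) ≤ deg w ∅ / 4 := by
    calc (X.card : ℝ) * (deg w ∅ / M / 4) ≤ M * (deg w ∅ / M / 4) := by gcongr
      _ = _ := by field_simp
  have h6 : deg w ∅ / 2 ≤ ((r + 1 : ℕ) : ℝ) * deg G ∅ := by
    refine htot.trans (le_mul_of_one_le_left (deg_nonneg hG0 _) ?_)
    push_cast
    have : (0 : ℝ) ≤ r := Nat.cast_nonneg r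
    linarith
  have h7 : deg w ∅ / 4 ≤ (heavy L p M w w').card * (K * (deg w ∅ / M)) := by linarith
  have h8 : deg w ∅ * (1 / 4) ≤ deg w ∅ * ((heavy L p M w w').card * (K / M)) := by
    calc _ = deg w ∅ / 4 := by ring
      _ ≤ _ := h7
      _ = _ := by ring
  have h9 := le_of_mul_le_mul_left h8 hW
  calc 1 / (4 * K) * M = 1 / 4 * (M / K) := by field_simp
    _ ≤ (heavy L p M w w').card * (K / M) * (M / K) := by gcongr
    _ = _ := by field_simp

/-- If many links were added, the resulting hypergraph is spread out. -/
theorem Inv.spread (hw : Spread (r + 1) X K p M w) (hK : 0 < K) (hL : 0 < L) (hp : 0 < p)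
    (hM : 0 < M) {j : ℕ} {w' : Finset U → ℝ} (h : Inv r X I K L p M w j w')
    (hbig : p * deg w ∅ ≤ 4 * deg w' ∅) : Spread r X (4 * (L + K)) p M w' where
  nonneg := h.nonneg
  card_eq := h.card_eq
  subset := h.subset
  pos := by
    have := mul_pos hp hw.pos
    linarith
  deg_le T hT := by
    calc p * deg w' T ≤ p * ((L + K) * p ^ T.card * (deg w ∅ / M)) :=
          mul_le_mul_of_nonneg_left (h.deg_le T hT) hp.le
      _ = (L + K) * p ^ T.card / M * (p * deg w ∅) := by ring
      _ ≤ (L + K) * p ^ T.card / M * (4 * deg w' ∅) := by gcongr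
      _ = _ := by ring

/-- The container theorem for one spread-out hypergraph. -/
theorem exists_container (p M : ℝ) (hp : 0 < p) (hM : 0 < M) (hpM : 1 ≤ p * M) (X : Finset U)
    (hX : (X.card : ℝ) ≤ M) : ∀ (r : ℕ) (K : ℝ), 0 < K → ∀ w : Finset U → ℝ,
    Spread r X K p M w → ∃ C : List (Finset U) → Finset U, ∀ I ⊆ X, Indep w I →
      ∃ T : List (Finset U), T.length = r ∧ (∀ S ∈ T, S ⊆ I ∧ (S.card : ℝ) ≤ 2 * (p * M)) ∧
        I ⊆ C T ∧ C T ⊆ X ∧ ((C T).card : ℝ) + gain r K * M ≤ X.card := by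
  intro r
  induction r with
  | zero =>
    intro K hK w hw
    -- A `0`-uniform weight of positive total has the edge `∅`, so no set is independent and any
    -- container function serves.
    refine ⟨fun _ => ∅, fun I _ hI => ?_⟩
    obtain ⟨e, -, he⟩ := exists_of_deg_ne_zero hw.pos.ne'
    have := card_eq_zero.1 (hw.card_eq e he)
    exact absurd (this ▸ empty_subset I) (hI e he)
  | succ r ih =>
    intro K hK w hw
    have hW := hw.pos
    set L := 4 * 2 ^ r * K ^ 2 with hLdef
    have hL : 0 < L := by positivity
    have hLK : 0 < 4 * (L + K) := by positivity
    choose! D hD using ih (4 * (L + K)) hLK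
    set n := ⌈p * M⌉₊ with hn
    have hn1 : p * M ≤ n := Nat.le_ceil _
    have hn2 : (n : ℝ) ≤ 2 * (p * M) := by
      have := Nat.ceil_lt_add_one (zero_le_one.trans hpM)
      linarith
    let run : Finset U → (Finset U → ℝ) × Finset U :=
      greedy (heavy L p M w) (addLink L p M w) n (fun _ => 0)
    classical
    -- The head of the list is the fingerprint of the current run; replaying it recovers `w'` and
    -- decides which case applies. The tail serves the recursive call.
    let C : List (Finset U) → Finset U := fun T =>
      if p * deg w ∅ ≤ 4 * deg (run (T.headD ∅)).1 ∅ then D (run (T.headD ∅)).1 T.tail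
      else X \ heavy L p M w (run (T.headD ∅)).1
    refine ⟨C, fun I hIX hI => ?_⟩
    obtain ⟨i, hi, hinv, hfinal⟩ := greedy_invariant (heavy L p M w) (addLink L p M w)
      (Q := Inv r X I K L p M w)
      (fun j s v hs hv hvI => hs.step hw hI hp hM hv hvI) n 0 (fun _ => 0)
      (inv_zero hw hK hL hp hM)
    rw [zero_add] at hinv
    have hFI : (run I).2 ⊆ I := greedy_snd_subset _ _ I n _
    have hFcard : ((run I).2.card : ℝ) ≤ 2 * (p * M) :=
      le_trans (Nat.cast_le.2 (card_greedy_snd_le _ _ I n _)) hn2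
    have hrun : run (run I).2 = run I := greedy_congr _ _ hFI n _ subset_rfl
    change Inv r X I K L p M w i (run I).1 at hinv
    change i = n ∨ heavy L p M w (run I).1 ∩ I = ∅ at hfinal
    by_cases hbig : p * deg w ∅ ≤ 4 * deg (run I).1 ∅
    · obtain ⟨T, hlen, hT, hIC, hCX, hcard⟩ :=
        hD (run I).1 (hinv.spread hw hK hL hp hM hbig) I hIX hinv.indep
      refine ⟨(run I).2 :: T, by simp [hlen], ?_, ?_⟩
      · intro S hS
        rcases List.mem_cons.1 hS with rfl | hS
        exacts [⟨hFI, hFcard⟩, hT S hS]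
      · have hCT : C ((run I).2 :: T) = D (run I).1 T := by
          simp only [C, List.headD_cons, List.tail_cons, hrun, if_pos hbig]
        rw [hCT]
        refine ⟨hIC, hCX, le_trans ?_ hcard⟩
        have : gain (r + 1) K ≤ gain r (4 * (L + K)) := min_le_right _ _
        gcongr
    · have hdisj : heavy L p M w (run I).1 ∩ I = ∅ := by
        -- All `n ≥ p * M` rounds would each have added `deg w ∅ / M / 4`, bringing `w'` to the
        -- weight required in the other case.
        refine hfinal.resolve_left fun hin => hbig ?_
        have h1 := hinv.total_ge
        rw [hin] at h1
        have h2 : p * M * (deg w ∅ / M / 4) ≤ n * (deg w ∅ / M / 4) := by gcongr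
        have h3 : p * M * (deg w ∅ / M / 4) = p * deg w ∅ / 4 := by field_simp
        linarith
      have hheavy := le_card_heavy hw hK hp hM hX
        ((Nat.cast_le.2 hi).trans hn2) hinv
      -- Padding with `∅` makes the length independent of the branch, so that concatenated
      -- fingerprints can later be split.
      refine ⟨(run I).2 :: List.replicate r ∅, by simp, ?_, ?_⟩
      · intro S hS
        rcases List.mem_cons.1 hS with rfl | hS
        · exact ⟨hFI, hFcard⟩
        · rw [(List.mem_replicate.1 hS).2]
          exact ⟨empty_subset _, by rw [card_empty]; push_cast; positivity⟩
      · have hCT : C ((run I).2 :: List.replicate r ∅) = X \ heavy L p M w (run I).1 := by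
          simp only [C, List.headD_cons, hrun, if_neg hbig]
        rw [hCT]
        refine ⟨fun v hv => mem_sdiff.2 ⟨hIX hv, fun hvh => ?_⟩, sdiff_subset, ?_⟩
        · exact notMem_empty v (hdisj ▸ mem_inter.2 ⟨hvh, hv⟩)
        · have h1 : gain (r + 1) K * M ≤ 1 / (4 * K) * M := by
            have : gain (r + 1) K ≤ 1 / (4 * K) := min_le_left _ _
            gcongr
          have h2 := card_sdiff_add_card_eq_card hheavy.1
          have h3 : ((X \ heavy L p M w (run I).1).card : ℝ) +
              (heavy L p M w (run I).1).card = X.card := by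
            rw [← h2, Nat.cast_add]
          linarith [hheavy.2]

/-- Iterating the container theorem: as long as `dense C` holds, there is a spread-out hypergraph
on `C` whose edges are not contained in any of the sets `I` with `good I`. -/
theorem exists_iterated_container (p M : ℝ) (hp : 0 < p) (hM : 0 < M) (hpM : 1 ≤ p * M) (r : ℕ)
    (K : ℝ) (hK : 0 < K) (dense : Finset U → Prop) (good : Finset U → Prop)
    (w : Finset U → Finset U → ℝ) (X : Finset U) (hX : (X.card : ℝ) ≤ M)
    (hw : ∀ C ⊆ X, dense C → Spread r C K p M (w C))
    (hgood : ∀ C ⊆ X, ∀ I, good I → Indep (w C) I) (k : ℕ) :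
    ∀ C₀ ⊆ X, ∃ C : List (Finset U) → Finset U, ∀ I ⊆ C₀, good I →
      ∃ T : List (Finset U), T.length = k * r ∧
        (∀ S ∈ T, S ⊆ I ∧ (S.card : ℝ) ≤ 2 * (p * M)) ∧ I ⊆ C T ∧ C T ⊆ C₀ ∧
        (¬ dense (C T) ∨ ((C T).card : ℝ) + k * (gain r K * M) ≤ C₀.card) := by
  induction k with
  | zero => exact fun C₀ _ => ⟨fun _ => C₀, fun I hI _ =>
      ⟨[], by simp, by simp, hI, subset_rfl, Or.inr (by simp)⟩⟩
  | succ k ih =>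
    intro C₀ hC₀
    by_cases hd : dense C₀
    · obtain ⟨D, hD⟩ := exists_container p M hp hM hpM C₀
        ((Nat.cast_le.2 (card_le_card hC₀)).trans hX) r K hK (w C₀) (hw C₀ hC₀ hd)
      choose! E hE using ih
      -- The first `r` sets determine the first container, and the remaining ones are decoded inside
      -- it.
      refine ⟨fun T => E (D (T.take r)) (T.drop r), fun I hI hIg => ?_⟩
      obtain ⟨T, hlen, hT, hID, hDC, hcard⟩ := hD I hI (hgood C₀ hC₀ I hIg)
      obtain ⟨T', hlen', hT', hIE, hED, hE'⟩ := hE (D T) (hDC.trans hC₀) I hID hIg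
      refine ⟨T ++ T', ?_, ?_, ?_⟩
      · rw [List.length_append, hlen, hlen']
        ring
      · intro S hS
        rcases List.mem_append.1 hS with hS | hS
        exacts [hT S hS, hT' S hS]
      · simp only [List.take_left' hlen, List.drop_left' hlen]
        refine ⟨hIE, hED.trans hDC, hE'.imp id fun h => ?_⟩
        push_cast
        linarith
    · refine ⟨fun _ => C₀, fun I hI _ =>
        ⟨List.replicate ((k + 1) * r) ∅, by simp, fun S hS => ?_, hI, subset_rfl, Or.inl hd⟩⟩
      rw [(List.mem_replicate.1 hS).2]
      exact ⟨empty_subset _, by rw [card_empty]; push_cast; positivity⟩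

end Step

end HypergraphContainer

namespace LGraph

open Finset HypergraphContainer

/-! ### Embeddings of `H` and the hypergraph of its copies. -/

section Embeddings

variable {ℓ N : ℕ} {V : Type*}

/-- The edge set of the copy of `H` given by an embedding of its vertices. -/
def image {W : Type*} (H : LGraph ℓ V) (f : V ↪ W) : Finset (Finset W) :=
  H.edges.map (mapEmbedding f).toEmbedding

theorem mem_image {W : Type*} {H : LGraph ℓ V} {f : V ↪ W} {A : Finset W} :
    A ∈ H.image f ↔ ∃ e ∈ H.edges, e.map f = A := by
  simp [image]

variable [Fintype V]

theorem free_iff {W : Type*} {H : LGraph ℓ V} {G : LGraph ℓ W} :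
    Free H G ↔ ∀ f : V ↪ W, ¬ H.image f ⊆ G.edges := by
  constructor
  · intro h f hf
    refine h ⟨univ.map f, H.image f, hf, fun A hA => ?_⟩ ⟨f, rfl, rfl⟩
    obtain ⟨e, -, rfl⟩ := mem_image.1 hA
    exact map_subset_map.2 (subset_univ e)
  · rintro h S ⟨f, -, hS⟩
    exact h f (by rw [image, ← hS]; exact S.edges_subset)

open Classical in
/-- The embeddings of `H` into the edge set `C`. -/
noncomputable def embeddings (H : LGraph ℓ V) (C : Finset (Finset (Fin N))) :
    Finset (V ↪ Fin N) :=
  {f | H.image f ⊆ C}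

theorem mem_embeddings {H : LGraph ℓ V} {C : Finset (Finset (Fin N))} {f : V ↪ Fin N} :
    f ∈ H.embeddings C ↔ H.image f ⊆ C := by
  simp [embeddings]

/-- A copy is determined by any embedding that realises it. -/
theorem copies_le_card_embeddings (H : LGraph ℓ V) (G : LGraph ℓ (Fin N)) :
    copies H G ≤ (H.embeddings G.edges).card := by
  classical
  have hf : ∀ S : G.Subgraph, S.IsCopy H → ∃ f ∈ H.embeddings G.edges,
      S.verts = univ.map f ∧ S.edges = H.image f := by
    rintro S ⟨f, h1, h2⟩
    exact ⟨f, mem_embeddings.2 (by rw [image, ← h2]; exact S.edges_subset), h1, h2⟩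
  rcases Set.eq_empty_or_nonempty {S : G.Subgraph | S.IsCopy H} with h0 | ⟨_, f₀, -⟩
  · simp [copies, h0]
  have : Nonempty (V ↪ Fin N) := ⟨f₀⟩
  choose! F hF using hf
  rw [copies, ← Set.ncard_coe_finset]
  refine Set.ncard_le_ncard_of_injOn F (fun S hS => (hF S hS).1) ?_ (finite_toSet _)
  intro S hS T hT hST
  obtain ⟨-, h1, h2⟩ := hF S hS
  obtain ⟨-, h3, h4⟩ := hF T hT
  rw [hST] at h1 h2
  exact Subgraph.ext (h1.trans h3.symm) (h2.trans h4.symm)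

open Classical in
/-- The weighted hypergraph of copies of `H` in `C`: its vertices are the edges of `C`. -/
noncomputable def copyWeight (H : LGraph ℓ V) (C A : Finset (Finset (Fin N))) : ℝ :=
  (((H.embeddings C).filter fun f => H.image f = A).card : ℝ)

theorem exists_of_copyWeight_ne_zero {H : LGraph ℓ V} {C A : Finset (Finset (Fin N))}
    (h : H.copyWeight C A ≠ 0) : ∃ f : V ↪ Fin N, H.image f ⊆ C ∧ H.image f = A := by
  classical
  have : (((H.embeddings C).filter fun f => H.image f = A)).Nonempty := by
    rw [← card_ne_zero]
    exact fun h0 => h (by rw [copyWeight, h0, Nat.cast_zero])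
  obtain ⟨f, hf⟩ := this
  obtain ⟨h1, h2⟩ := mem_filter.1 hf
  exact ⟨f, mem_embeddings.1 h1, h2⟩

open Classical in
theorem deg_copyWeight (H : LGraph ℓ V) (C T : Finset (Finset (Fin N))) :
    deg (H.copyWeight C) T = (((H.embeddings C).filter fun f => T ⊆ H.image f).card : ℝ) := by
  rw [card_eq_sum_card_fiberwise (f := H.image) (t := univ.filter fun A => T ⊆ A)
    (fun f hf => by simpa using (mem_filter.1 hf).2)]
  rw [deg]
  push_cast
  refine sum_congr (by ext; simp) fun A hA => ?_
  rw [copyWeight, filter_filter]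
  congr 2
  ext f
  simp only [mem_filter]
  refine and_congr_right fun _ => ⟨fun h => ⟨h ▸ (mem_filter.1 hA).2, h⟩, fun h => h.2⟩

theorem deg_copyWeight_empty (H : LGraph ℓ V) (C : Finset (Finset (Fin N))) :
    deg (H.copyWeight C) ∅ = ((H.embeddings C).card : ℝ) := by
  classical
  rw [deg_copyWeight]
  simp

open Classical in
/-- Embeddings carrying a given set of vertices into a given set of the same size. -/
theorem card_embeddings_mapsTo_le (S : Finset V) (R : Finset (Fin N)) (hR : R.card = S.card) :
    (univ.filter fun f : V ↪ Fin N => ∀ x ∈ S, f x ∈ R).card ≤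
      Fintype.card V ^ Fintype.card V * N ^ (Fintype.card V - S.card) := by
  have h1 : (univ.filter fun f : V ↪ Fin N => ∀ x ∈ S, f x ∈ R).card ≤
      (Fintype.piFinset fun x : V => if x ∈ S then R else univ).card := by
    refine card_le_card_of_injOn (fun f => (f : V → Fin N)) ?_
      (fun f _ g _ h => DFunLike.coe_injective h)
    intro f hf
    rw [mem_coe, Fintype.mem_piFinset]
    intro x
    split_ifs with hx
    exacts [(mem_filter.1 hf).2 x hx, mem_univ _]
  refine h1.trans ?_
  rw [Fintype.card_piFinset]
  have h2 : ∀ x : V, (if x ∈ S then R else (univ : Finset (Fin N))).card =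
      if x ∈ S then R.card else N := fun x => by split_ifs <;> simp
  simp only [h2]
  rw [prod_ite, prod_const, prod_const, filter_mem_eq_inter, univ_inter, hR]
  have h3 : (univ.filter fun x => x ∉ S).card = Fintype.card V - S.card := by
    rw [← card_compl]
    congr 1
    ext; simp
  rw [h3]
  refine Nat.mul_le_mul_right _ ?_
  rcases Nat.eq_zero_or_pos (Fintype.card V) with h0 | h0
  · have : S.card = 0 := by have := card_le_univ S; omega
    simp [h0, this]
  · exact (Nat.pow_le_pow_left (card_le_univ S) _).trans
      (Nat.pow_le_pow_right h0 (card_le_univ S))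

end Embeddings

/-! ### Degree bounds from `m(H)`. -/

section Density

variable {ℓ : ℕ} {V : Type*} [Fintype V] {H : LGraph ℓ V}

theorem mParam_pos (hH : 2 ≤ H.edges.card) : 0 < H.mParam := by
  let S : H.Subgraph := ⟨univ, H.edges, subset_rfl, fun e _ => subset_univ e⟩
  have hS : 1 < S.edges.card := hH
  have h1 := (isGreatest_mParam H hH).2 ⟨S, hS, rfl⟩
  have h2 : (ℓ : ℝ) < S.verts.card := by exact_mod_cast S.lt_card_verts hS
  have h3 : (1 : ℝ) < S.edges.card := by exact_mod_cast hS
  exact lt_of_lt_of_le (div_pos (by linarith) (by linarith)) h1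

-- The maximality of `m(H)` applied to the subgraph spanned by `J`, rearranged. A single edge falls
-- outside that maximum but gives equality.
open Classical in
theorem sub_one_div_mParam_le (hH : 2 ≤ H.edges.card) {J : Finset (Finset V)} (hJ : J ⊆ H.edges)
    (hne : J.Nonempty) :
    ((J.card : ℝ) - 1) / H.mParam + ℓ ≤ (J.biUnion id).card := by
  have hm := mParam_pos hH
  rcases (Nat.one_le_iff_ne_zero.2 (card_ne_zero.2 hne)).eq_or_lt with h1 | h1
  · obtain ⟨e, rfl⟩ := card_eq_one.1 h1.symm
    have := H.uniform e (hJ (mem_singleton_self e))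
    simp [this]
  · let S : H.Subgraph := ⟨J.biUnion id, J, hJ, fun e he => subset_biUnion_of_mem id he⟩
    have hS : 1 < S.edges.card := h1
    have h2 := (isGreatest_mParam H hH).2 ⟨S, hS, rfl⟩
    have h3 : (ℓ : ℝ) < (J.biUnion id).card := by exact_mod_cast S.lt_card_verts hS
    change ((J.card : ℝ) - 1) / ((J.biUnion id).card - ℓ) ≤ H.mParam at h2
    rw [div_le_iff₀ (by linarith)] at h2
    have : ((J.card : ℝ) - 1) / H.mParam ≤ (J.biUnion id).card - ℓ := by
      rw [div_le_iff₀ hm]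
      linarith
    linarith

/-- Two edges span at most `2 * ℓ` and at least `ℓ + 1 / m(H)` vertices. This yields `1 ≤ p * M` for
the container theorem. -/
theorem exponent_nonneg (hH : 2 ≤ H.edges.card) : 0 ≤ (ℓ : ℝ) - 1 / H.mParam := by
  classical
  obtain ⟨J, hJ, hcard⟩ := exists_subset_card_eq hH
  have h1 := sub_one_div_mParam_le hH hJ (card_pos.1 (by omega))
  have h2 : (J.biUnion id).card ≤ 2 * ℓ := by
    rw [← hcard]
    exact card_biUnion_le_card_mul _ _ _ fun e he => (H.uniform e (hJ he)).le
  have h3 : ((J.biUnion id).card : ℝ) ≤ 2 * ℓ := by exact_mod_cast h2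
  rw [hcard] at h1
  norm_num at h1
  rw [one_div]
  linarith

-- Split the embeddings by the set `J` of edges of `H` mapped onto `T`. The vertices spanned by `J`
-- must go into those spanned by `T`, which leaves a free choice only for the other vertices of `H`.
open Classical in
theorem deg_copyWeight_le {N : ℕ} (hN : 1 ≤ N) (hH : 2 ≤ H.edges.card)
    (C T : Finset (Finset (Fin N))) (hT : T.Nonempty) :
    (N : ℝ) ^ (-(1 / H.mParam)) * deg (H.copyWeight C) T ≤
      2 ^ H.edges.card * (Fintype.card V : ℝ) ^ Fintype.card V *
        ((N : ℝ) ^ (-(1 / H.mParam))) ^ T.card *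
          ((N : ℝ) ^ Fintype.card V / (N : ℝ) ^ ℓ) := by
  have hN0 : (0 : ℝ) < N := by exact_mod_cast hN
  set p := (N : ℝ) ^ (-(1 / H.mParam)) with hp
  have hp0 : 0 < p := Real.rpow_pos_of_pos hN0 _
  set b : ℝ := (Fintype.card V : ℝ) ^ Fintype.card V * p ^ T.card *
    ((N : ℝ) ^ Fintype.card V / (N : ℝ) ^ ℓ) with hb
  have hb0 : 0 ≤ b := by positivity
  let Φ : Finset (Finset V) → Finset (V ↪ Fin N) := fun J =>
    univ.filter fun f => J.map (mapEmbedding f).toEmbedding = T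
  have hcover : ((H.embeddings C).filter fun f => T ⊆ H.image f) ⊆
      H.edges.powerset.biUnion Φ := by
    intro f hf
    have hTf := (mem_filter.1 hf).2
    refine mem_biUnion.2 ⟨H.edges.filter fun e => e.map f ∈ T,
      mem_powerset.2 (filter_subset _ _), mem_filter.2 ⟨mem_univ f, ?_⟩⟩
    ext A
    simp only [mem_map, mem_filter, RelEmbedding.coe_toEmbedding, mapEmbedding_apply]
    constructor
    · rintro ⟨e, ⟨-, he⟩, rfl⟩
      exact he
    · intro hA
      obtain ⟨e, he, rfl⟩ := mem_image.1 (hTf hA)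
      exact ⟨e, ⟨he, hA⟩, rfl⟩
  have hΦ : ∀ J ∈ H.edges.powerset, p * ((Φ J).card : ℝ) ≤ b := by
    intro J hJ
    rw [mem_powerset] at hJ
    rcases (Φ J).eq_empty_or_nonempty with h0 | ⟨g, hg⟩
    · rw [h0, card_empty, Nat.cast_zero, mul_zero]
      exact hb0
    have hgT := (mem_filter.1 hg).2
    have hJT : J.card = T.card := by rw [← hgT, card_map]
    have hJne : J.Nonempty := card_pos.1 (hJT ▸ card_pos.2 hT)
    have hRS : ∀ f ∈ Φ J, T.biUnion id = (J.biUnion id).map f := by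
      intro f hf
      rw [← (mem_filter.1 hf).2]
      ext x
      simp only [mem_biUnion, mem_map, id]
      constructor
      · rintro ⟨A, ⟨e, he, rfl⟩, hx⟩
        obtain ⟨y, hy, rfl⟩ := mem_map.1 hx
        exact ⟨y, ⟨e, he, hy⟩, rfl⟩
      · rintro ⟨y, ⟨e, he, hy⟩, rfl⟩
        exact ⟨_, ⟨e, he, rfl⟩, mem_map_of_mem f hy⟩
    have hle : (Φ J).card ≤ Fintype.card V ^ Fintype.card V *
        N ^ (Fintype.card V - (J.biUnion id).card) := by
      refine (card_le_card fun f hf => ?_).trans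
        (card_embeddings_mapsTo_le (J.biUnion id) (T.biUnion id) (by rw [hRS g hg, card_map]))
      refine mem_filter.2 ⟨mem_univ f, fun x hx => ?_⟩
      rw [hRS f hf]
      exact mem_map_of_mem f hx
    have hs : (J.biUnion id).card ≤ Fintype.card V := card_le_univ _
    have hexp := sub_one_div_mParam_le hH hJ hJne
    -- With all factors written as powers of `N`, comparing exponents is exactly the span bound
    -- `hexp`.
    have hkey : p * (N : ℝ) ^ (Fintype.card V - (J.biUnion id).card) ≤
        p ^ T.card * ((N : ℝ) ^ Fintype.card V / (N : ℝ) ^ ℓ) := by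
      rw [← hJT, hp, ← Real.rpow_natCast, ← Real.rpow_natCast, ← Real.rpow_natCast,
        ← Real.rpow_natCast, ← Real.rpow_mul hN0.le, ← Real.rpow_add hN0, ← Real.rpow_sub hN0,
        ← Real.rpow_add hN0]
      refine Real.rpow_le_rpow_of_exponent_le (by exact_mod_cast hN) ?_
      rw [Nat.cast_sub hs]
      have : ((J.card : ℝ) - 1) / H.mParam = J.card * (1 / H.mParam) - 1 / H.mParam := by ring
      linarith
    calc p * ((Φ J).card : ℝ)
        ≤ p * ((Fintype.card V : ℝ) ^ Fintype.card V *
          (N : ℝ) ^ (Fintype.card V - (J.biUnion id).card)) := by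
          refine mul_le_mul_of_nonneg_left ?_ hp0.le
          exact_mod_cast hle
      _ = (Fintype.card V : ℝ) ^ Fintype.card V *
          (p * (N : ℝ) ^ (Fintype.card V - (J.biUnion id).card)) := by ring
      _ ≤ (Fintype.card V : ℝ) ^ Fintype.card V *
          (p ^ T.card * ((N : ℝ) ^ Fintype.card V / (N : ℝ) ^ ℓ)) := by gcongr
      _ = b := by rw [hb]; ring
  rw [deg_copyWeight]
  have hsum : (((H.embeddings C).filter fun f => T ⊆ H.image f).card : ℝ) ≤
      ∑ J ∈ H.edges.powerset, ((Φ J).card : ℝ) := by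
    exact_mod_cast (card_le_card hcover).trans card_biUnion_le
  calc p * (((H.embeddings C).filter fun f => T ⊆ H.image f).card : ℝ)
      ≤ ∑ J ∈ H.edges.powerset, p * ((Φ J).card : ℝ) := by
        rw [← mul_sum]
        exact mul_le_mul_of_nonneg_left hsum hp0.le
    _ ≤ ∑ J ∈ H.edges.powerset, b := sum_le_sum hΦ
    _ = 2 ^ H.edges.card * b := by
        rw [sum_const, card_powerset, nsmul_eq_mul]; push_cast; rfl
    _ = _ := by rw [hb]; ring

theorem spread_copyWeight {N : ℕ} (hN : 1 ≤ N) (hH : 2 ≤ H.edges.card) {δ : ℝ} (hδ : 0 < δ)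
    (C : Finset (Finset (Fin N)))
    (hC : δ * (N : ℝ) ^ Fintype.card V < (H.embeddings C).card) :
    Spread H.edges.card C (2 ^ H.edges.card * (Fintype.card V : ℝ) ^ Fintype.card V / δ)
      ((N : ℝ) ^ (-(1 / H.mParam))) ((N : ℝ) ^ ℓ) (H.copyWeight C) where
  nonneg A := Nat.cast_nonneg _
  card_eq A hA := by
    obtain ⟨f, -, rfl⟩ := exists_of_copyWeight_ne_zero hA
    exact card_map _
  subset A hA := by
    obtain ⟨f, h, rfl⟩ := exists_of_copyWeight_ne_zero hA
    exact h
  pos := by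
    rw [deg_copyWeight_empty]
    exact lt_of_le_of_lt (by positivity) hC
  deg_le T hT := by
    have hN0 : (0 : ℝ) < N := by exact_mod_cast hN
    refine (deg_copyWeight_le hN hH C T hT).trans ?_
    rw [deg_copyWeight_empty]
    set b : ℝ := 2 ^ H.edges.card * (Fintype.card V : ℝ) ^ Fintype.card V
    have hp0 : 0 < (N : ℝ) ^ (-(1 / H.mParam)) := Real.rpow_pos_of_pos hN0 _
    calc b * ((N : ℝ) ^ (-(1 / H.mParam))) ^ T.card * ((N : ℝ) ^ Fintype.card V / (N : ℝ) ^ ℓ)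
        = b / δ * ((N : ℝ) ^ (-(1 / H.mParam))) ^ T.card *
          (δ * (N : ℝ) ^ Fintype.card V / (N : ℝ) ^ ℓ) := by field_simp
      _ ≤ _ := by gcongr

theorem indep_copyWeight {N : ℕ} {I : LGraph ℓ (Fin N)} (hI : Free H I)
    (C : Finset (Finset (Fin N))) : Indep (H.copyWeight C) I.edges := by
  intro A hA hAI
  obtain ⟨f, -, rfl⟩ := exists_of_copyWeight_ne_zero hA
  exact free_iff.1 hI f hAI

end Density

end LGraph

namespace LGraph

open Finset HypergraphContainer

/-! ### Supersaturation by averaging over `m`-sets. -/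

section Supersaturation

variable {ℓ N : ℕ} {V : Type*} [Fintype V] {H : LGraph ℓ V}

theorem card_induced_le (C : LGraph ℓ (Fin N)) {m : ℕ} {M : Finset (Fin N)} (hM : M.card = m)
    (hfree : ∀ f ∈ H.embeddings C.edges, ¬ univ.map f ⊆ M) :
    (C.edges.filter fun e => e ⊆ M).card ≤ extremalNumber m H := by
  let g : Fin m ↪ Fin N := (M.orderEmbOfFin hM).toEmbedding
  have hg : univ.map g = M := by
    rw [map_eq_image]
    exact M.image_orderEmbOfFin_univ hM
  let φ : Finset (Fin m) ↪ Finset (Fin N) := (mapEmbedding g).toEmbedding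
  let G : LGraph ℓ (Fin m) :=
    ⟨univ.filter fun e => e.map g ∈ C.edges, fun e he => by
      rw [← card_map g]
      exact C.uniform _ (mem_filter.1 he).2⟩
  have hG : Free H G := by
    rw [free_iff]
    intro f hf
    refine hfree (f.trans g) (mem_embeddings.2 fun A hA => ?_) ?_
    · obtain ⟨e, he, rfl⟩ := mem_image.1 hA
      rw [← map_map]
      exact (mem_filter.1 (hf (mem_image.2 ⟨e, he, rfl⟩))).2
    · rw [← map_map, ← hg]
      exact map_subset_map.2 (subset_univ _)
  have hsub : (C.edges.filter fun e => e ⊆ M) ⊆ G.edges.map φ := by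
    intro e he
    obtain ⟨he, heM⟩ := mem_filter.1 he
    rw [← hg] at heM
    obtain ⟨e', -, rfl⟩ := subset_map_iff.1 heM
    exact mem_map.2 ⟨e', mem_filter.2 ⟨mem_univ _, he⟩, rfl⟩
  calc _ ≤ (G.edges.map φ).card := card_le_card hsub
    _ = G.edges.card := card_map _
    _ ≤ _ := le_csSup (bddAbove_free m H) ⟨G, hG, rfl⟩

/-- Averaging the number of edges over all sets of `m` vertices. -/
theorem card_edges_mul_choose_le (C : LGraph ℓ (Fin N)) {m : ℕ} (hℓ : ℓ ≤ m)
    (hv : Fintype.card V ≤ m) :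
    C.edges.card * (N - ℓ).choose (m - ℓ) ≤
      N.choose m * extremalNumber m H +
        (H.embeddings C.edges).card * (N - Fintype.card V).choose (m - Fintype.card V) *
          m.choose ℓ := by
  classical
  obtain ⟨𝓜, h𝓜⟩ : ∃ 𝓜 : Finset (Finset (Fin N)), 𝓜 = powersetCard m univ := ⟨_, rfl⟩
  have hcard𝓜 : 𝓜.card = N.choose m := by
    rw [h𝓜, card_powersetCard, card_univ, Fintype.card_fin]
  have hsuper : ∀ s : Finset (Fin N), s.card ≤ m →
      (𝓜.filter fun M => s ⊆ M).card = (N - s.card).choose (m - s.card) := fun s hs => by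
    rw [h𝓜, card_filter_powersetCard_subset s univ m (subset_univ s) hs, card_univ, Fintype.card_fin]
  have hcardM : ∀ M ∈ 𝓜, M.card = m := fun M hM => (mem_powersetCard.1 (h𝓜 ▸ hM)).2
  -- A set `M` containing no copy induces an `H`-free graph. Otherwise the trivial bound `m.choose
  -- ℓ` is charged to the embeddings inside `M`.
  have key : ∀ M ∈ 𝓜, (C.edges.filter fun e => e ⊆ M).card ≤ extremalNumber m H +
      ((H.embeddings C.edges).filter fun f => univ.map f ⊆ M).card * m.choose ℓ := by
    intro M hM
    by_cases h : ∃ f ∈ H.embeddings C.edges, univ.map f ⊆ M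
    · obtain ⟨f, hf, hfM⟩ := h
      have h1 : 1 ≤ ((H.embeddings C.edges).filter fun f => univ.map f ⊆ M).card :=
        card_pos.2 ⟨f, mem_filter.2 ⟨hf, hfM⟩⟩
      have h2 : (C.edges.filter fun e => e ⊆ M).card ≤ m.choose ℓ := by
        rw [← hcardM M hM, ← card_powersetCard]
        exact card_le_card fun e he =>
          mem_powersetCard.2 ⟨(mem_filter.1 he).2, C.uniform e (mem_filter.1 he).1⟩
      exact h2.trans ((Nat.le_mul_of_pos_left _ h1).trans (Nat.le_add_left _ _))
    · push Not at h
      exact (card_induced_le C (hcardM M hM) h).trans (Nat.le_add_right _ _)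
  have hleft : C.edges.card * (N - ℓ).choose (m - ℓ) =
      ∑ M ∈ 𝓜, (C.edges.filter fun e => e ⊆ M).card := by
    have h1 : ∑ e ∈ C.edges, (𝓜.filter fun M => e ⊆ M).card =
        C.edges.card * (N - ℓ).choose (m - ℓ) := by
      refine sum_const_nat fun e he => ?_
      rw [hsuper e (by rw [C.uniform e he]; exact hℓ), C.uniform e he]
    rw [← h1]
    exact sum_card_bipartiteAbove_eq_sum_card_bipartiteBelow fun (e M : Finset (Fin N)) => e ⊆ M
  have hright : ∑ M ∈ 𝓜, ((H.embeddings C.edges).filter fun f => univ.map f ⊆ M).card =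
      (H.embeddings C.edges).card * (N - Fintype.card V).choose (m - Fintype.card V) := by
    have h1 : ∑ f ∈ H.embeddings C.edges, (𝓜.filter fun M => univ.map f ⊆ M).card =
        (H.embeddings C.edges).card * (N - Fintype.card V).choose (m - Fintype.card V) := by
      refine sum_const_nat fun f _ => ?_
      have hf : (univ.map f).card = Fintype.card V := by rw [card_map, card_univ]
      rw [hsuper _ (hf.trans_le hv), hf]
    rw [← h1]
    exact (sum_card_bipartiteAbove_eq_sum_card_bipartiteBelow
      fun (f : V ↪ Fin N) M => univ.map f ⊆ M).symm
  rw [hleft, ← hright, sum_mul, ← hcard𝓜, ← smul_eq_mul, ← sum_const, ← sum_add_distrib]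
  exact sum_le_sum key

variable (H)

/-- Supersaturation: an `ℓ`-graph with few embeddings of `H` has density at most `π(H) + ε`. -/
theorem supersaturation {ε : ℝ} (hε : 0 < ε) :
    ∃ δ : ℝ, 0 < δ ∧ ∃ N₀ : ℕ, ∀ N : ℕ, N₀ ≤ N → ∀ C : LGraph ℓ (Fin N),
      ((H.embeddings C.edges).card : ℝ) ≤ δ * (N : ℝ) ^ Fintype.card V →
        (C.edges.card : ℝ) ≤ (H.turanDensity + ε) * (N.choose ℓ : ℝ) := by
  set v := Fintype.card V with hv
  obtain ⟨m, hm, hmℓ, hmv⟩ : ∃ m : ℕ,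
      (extremalNumber m H : ℝ) / (m.choose ℓ : ℝ) < H.turanDensity + ε / 2 ∧ ℓ ≤ m ∧ v ≤ m :=
    (((tendsto_turanDensity H).eventually_lt_const (by linarith)).and
      ((Filter.eventually_ge_atTop ℓ).and (Filter.eventually_ge_atTop v))).exists
  have hmℓ0 : (0 : ℝ) < m.choose ℓ := by exact_mod_cast Nat.choose_pos hmℓ
  have hmv0 : (0 : ℝ) < m.choose v := by exact_mod_cast Nat.choose_pos hmv
  have hvf : (0 : ℝ) < v.factorial := by exact_mod_cast v.factorial_pos
  rw [div_lt_iff₀ hmℓ0] at hm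
  -- Since `N ≥ 2 * v`, `N.choose v` is at least `N ^ v / (2 ^ v * v!)`; this `δ` then makes the
  -- embedding term in the average at most `ε / 2` of the whole.
  refine ⟨ε / 2 / (2 ^ v * v.factorial * m.choose v), by positivity, 2 * v + m, ?_⟩
  intro N hN C hC
  have hNv : (N : ℝ) ^ v / (2 ^ v * v.factorial) ≤ N.choose v := by
    refine le_trans ?_ (Nat.pow_le_choose v N)
    rw [← div_div, ← div_pow]
    gcongr
    rw [Nat.cast_sub (by omega)]
    push_cast
    have : (2 * v : ℝ) ≤ N := by exact_mod_cast (by omega : 2 * v ≤ N)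
    linarith
  have hcv : (N.choose m : ℝ) * m.choose v = N.choose v * (N - v).choose (m - v) := by
    exact_mod_cast Nat.choose_mul hmv
  have hcℓ : (N.choose m : ℝ) * m.choose ℓ = N.choose ℓ * (N - ℓ).choose (m - ℓ) := by
    exact_mod_cast Nat.choose_mul hmℓ
  have havg : (C.edges.card : ℝ) * (N - ℓ).choose (m - ℓ) ≤ N.choose m * extremalNumber m H +
      (H.embeddings C.edges).card * (N - v).choose (m - v) * m.choose ℓ := by
    exact_mod_cast card_edges_mul_choose_le (H := H) C hmℓ hmv
  have hemb : ((H.embeddings C.edges).card : ℝ) * (N - v).choose (m - v) ≤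
      ε / 2 * N.choose m := by
    calc ((H.embeddings C.edges).card : ℝ) * (N - v).choose (m - v)
        ≤ ε / 2 / (2 ^ v * v.factorial * m.choose v) * (N : ℝ) ^ v * (N - v).choose (m - v) := by
          gcongr
      _ = ε / 2 / m.choose v * (N - v).choose (m - v) *
            ((N : ℝ) ^ v / (2 ^ v * v.factorial)) := by field_simp
      _ ≤ ε / 2 / m.choose v * (N - v).choose (m - v) * N.choose v := by gcongr
      _ = ε / 2 / m.choose v * (N.choose m * m.choose v) := by rw [hcv]; ring
      _ = _ := by field_simp
  have hpos : (0 : ℝ) < (N - ℓ).choose (m - ℓ) := by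
    exact_mod_cast Nat.choose_pos (by omega)
  refine le_of_mul_le_mul_right ?_ hpos
  calc (C.edges.card : ℝ) * (N - ℓ).choose (m - ℓ)
      ≤ N.choose m * extremalNumber m H +
        (H.embeddings C.edges).card * (N - v).choose (m - v) * m.choose ℓ := havg
    _ ≤ N.choose m * ((H.turanDensity + ε / 2) * m.choose ℓ) +
        ε / 2 * N.choose m * m.choose ℓ := by gcongr
    _ = (H.turanDensity + ε) * (N.choose m * m.choose ℓ) := by ring
    _ = _ := by rw [hcℓ]; ring

end Supersaturation

end LGraph

/-! ### Counting fingerprints and assembling the theorem. -/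

namespace HypergraphContainer

open Finset

/-- There are at most `(|X| + 1) ^ n` subsets of `X` of size at most `n`. -/
theorem card_filter_powerset_card_le {U : Type*} (X : Finset U) (n : ℕ) :
    (X.powerset.filter fun S => S.card ≤ n).card ≤ (X.card + 1) ^ n := by
  classical
  have h : (X.powerset.filter fun S => S.card ≤ n) ⊆
      (Fintype.piFinset fun _ : Fin n => insertNone X).image
        fun φ => eraseNone (univ.image φ) := by
    intro S hS
    obtain ⟨hSX, hSn⟩ := mem_filter.1 hS
    rw [mem_powerset] at hSX
    -- List the elements of `S` and fill the unused positions with `none`, the extra symbol behind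
    -- the `+ 1`.
    refine Finset.mem_image.2 ⟨fun i => S.toList[(i : ℕ)]?, ?_, ?_⟩
    · rw [Fintype.mem_piFinset]
      intro i
      rw [mem_insertNone]
      intro a ha
      exact hSX (mem_toList.1 (List.mem_of_getElem? ha))
    · ext a
      rw [mem_eraseNone, Finset.mem_image]
      constructor
      · rintro ⟨i, -, hi⟩
        exact mem_toList.1 (List.mem_of_getElem? hi)
      · intro ha
        obtain ⟨i, hi, rfl⟩ := List.mem_iff_getElem.1 (mem_toList.2 ha)
        exact ⟨⟨i, by rw [length_toList] at hi; omega⟩, mem_univ _,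
          List.getElem?_eq_getElem hi⟩
  calc _ ≤ _ := card_le_card h
    _ ≤ _ := card_image_le
    _ = _ := by simp [Fintype.card_piFinset, card_insertNone]

end HypergraphContainer

namespace LGraph

open Finset HypergraphContainer

/-- The `ℓ`-graph of the `ℓ`-element members of a family of sets. -/
def ofFamily (ℓ : ℕ) {W : Type*} (F : Finset (Finset W)) : LGraph ℓ W :=
  ⟨F.filter fun e => e.card = ℓ, fun _ he => (mem_filter.1 he).2⟩

theorem edges_ofFamily {ℓ : ℕ} {W : Type*} {F : Finset (Finset W)} (hF : ∀ e ∈ F, e.card = ℓ) :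
    (ofFamily ℓ F).edges = F :=
  filter_true_of_mem hF

/-- Containers for `H`-free `ℓ`-graphs on `N` vertices, as a function of the fingerprint. -/
theorem exists_containers_of_free {ℓ : ℕ} {V : Type*} [Fintype V] (H : LGraph ℓ V)
    (hH : 2 ≤ H.edges.card) {δ : ℝ} (hδ : 0 < δ) :
    ∃ s : ℕ, ∀ N : ℕ, 1 ≤ N →
      ∃ C : List (Finset (Finset (Fin N))) → Finset (Finset (Fin N)),
        ∀ I : LGraph ℓ (Fin N), Free H I → ∃ T : List (Finset (Finset (Fin N))),
          T.length = s ∧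
          (∀ S ∈ T, S ⊆ I.edges ∧ (S.card : ℝ) ≤ 2 * (N : ℝ) ^ ((ℓ : ℝ) - 1 / H.mParam)) ∧
          I.edges ⊆ C T ∧ (∀ e ∈ C T, e.card = ℓ) ∧
          ((H.embeddings (C T)).card : ℝ) ≤ δ * (N : ℝ) ^ Fintype.card V := by
  have hV : 0 < Fintype.card V := by
    rw [Fintype.card_pos_iff]
    by_contra hV
    rw [not_nonempty_iff] at hV
    have : H.edges.card ≤ 1 :=
      card_le_one.2 fun a _ b _ => by rw [eq_empty_of_isEmpty a, eq_empty_of_isEmpty b]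
    omega
  set K : ℝ := 2 ^ H.edges.card * (Fintype.card V : ℝ) ^ Fintype.card V / δ with hKdef
  have hK : 0 < K := by
    have : (0 : ℝ) < Fintype.card V := by exact_mod_cast hV
    positivity
  have hg := gain_pos H.edges.card hK
  -- With `k * gain > 1`, `k` successful rounds would remove more than `M` vertices from a set of at
  -- most `M`, so the process must end at a family with few embeddings.
  obtain ⟨k, hk⟩ := exists_nat_gt (1 / gain H.edges.card K)
  rw [div_lt_iff₀ hg] at hk
  refine ⟨k * H.edges.card, fun N hN => ?_⟩
  have hN0 : (0 : ℝ) < N := by exact_mod_cast hN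
  set p := (N : ℝ) ^ (-(1 / H.mParam)) with hp
  have hp0 : 0 < p := Real.rpow_pos_of_pos hN0 _
  set M := (N : ℝ) ^ ℓ with hM
  have hM0 : 0 < M := by positivity
  have hpM : p * M = (N : ℝ) ^ ((ℓ : ℝ) - 1 / H.mParam) := by
    rw [hp, hM, ← Real.rpow_natCast, ← Real.rpow_add hN0]
    congr 1
    ring
  have hpM1 : 1 ≤ p * M := by
    rw [hpM]
    exact Real.one_le_rpow (by exact_mod_cast hN) (exponent_nonneg hH)
  set X : Finset (Finset (Fin N)) := powersetCard ℓ univ with hX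
  have hXM : (X.card : ℝ) ≤ M := by
    rw [hX, card_powersetCard, card_univ, Fintype.card_fin, hM]
    exact_mod_cast Nat.choose_le_pow N ℓ
  obtain ⟨C, hC⟩ := exists_iterated_container p M hp0 hM0 hpM1 H.edges.card K hK
    (fun C => δ * (N : ℝ) ^ Fintype.card V < (H.embeddings C).card)
    (fun I => ∃ G : LGraph ℓ (Fin N), Free H G ∧ G.edges = I) H.copyWeight X hXM
    (fun C _ hd => spread_copyWeight hN hH hδ C hd)
    (fun C _ I ⟨G, hG, hGI⟩ => hGI ▸ indep_copyWeight hG C) k X subset_rfl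
  refine ⟨C, fun I hI => ?_⟩
  have hIX : I.edges ⊆ X := fun e he => mem_powersetCard.2 ⟨subset_univ e, I.uniform e he⟩
  obtain ⟨T, hlen, hT, hIC, hCX, hend⟩ := hC I.edges hIX ⟨I, hI, rfl⟩
  refine ⟨T, hlen, fun S hS => hpM ▸ hT S hS, hIC,
    fun e he => (mem_powersetCard.1 (hCX he)).2, ?_⟩
  refine hend.elim not_lt.1 fun h => ?_
  have h1 : 1 * M < k * gain H.edges.card K * M := mul_lt_mul_of_pos_right hk hM0
  have h2 : (0 : ℝ) ≤ (C T).card := Nat.cast_nonneg _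
  linarith

end LGraph

theorem theorem1p3 {ℓ : ℕ} {V : Type*} [Fintype V] (H : LGraph ℓ V) (hH : 2 ≤ H.edges.card)
    (ε : ℝ) (hε : 0 < ε) :
    ∃ c : ℝ, 0 < c ∧ ∃ N₀ : ℕ, ∀ N : ℕ, N₀ ≤ N →
      ∃ (𝒞 : Finset (LGraph ℓ (Fin N))) (K : List (LGraph ℓ (Fin N)) → LGraph ℓ (Fin N)),
        (∀ I : LGraph ℓ (Fin N), LGraph.Free H I →
          ∃ C ∈ 𝒞, I.edges ⊆ C.edges ∧
            ∃ T : List (LGraph ℓ (Fin N)),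
              (∀ S ∈ T, S.edges ⊆ I.edges) ∧
              (T.length : ℝ) ≤ c ∧
              (((T.map fun S => S.edges.card).sum : ℕ) : ℝ)
                ≤ c * (N : ℝ) ^ ((ℓ : ℝ) - 1 / H.mParam) ∧
              C = K T) ∧
        (∀ C ∈ 𝒞,
          (LGraph.copies H C : ℝ) ≤ ε * (N : ℝ) ^ Fintype.card V ∧
          (C.edges.card : ℝ) ≤ (H.turanDensity + ε) * (N.choose ℓ : ℝ)) ∧
        Real.log (𝒞.card : ℝ)
          ≤ c * (N : ℝ) ^ ((ℓ : ℝ) - 1 / H.mParam) * Real.log (N : ℝ) := by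
  classical
  obtain ⟨δ, hδ, N₁, hsuper⟩ := H.supersaturation hε
  obtain ⟨s, hs⟩ := LGraph.exists_containers_of_free H hH (lt_min hδ hε)
  -- There are `s` fingerprints of size at most `2 * x`, each element having at most `N ^ (ℓ + 1)`
  -- codes, which uses `N ≥ 2`. The `+ 1` keeps `c` positive when `s = 0`.
  refine ⟨2 * s * (ℓ + 1) + 1, by positivity, N₁ + 2, fun N hN => ?_⟩
  have hN2 : (2 : ℝ) ≤ N := by exact_mod_cast (by omega : 2 ≤ N)
  obtain ⟨D, hD⟩ := hs N (by omega)
  set x : ℝ := (N : ℝ) ^ ((ℓ : ℝ) - 1 / H.mParam) with hx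
  have hx0 : 0 < x := Real.rpow_pos_of_pos (by linarith) _
  have hlog : 0 ≤ Real.log N := Real.log_nonneg (by linarith)
  let X : Finset (Finset (Fin N)) := Finset.powersetCard ℓ Finset.univ
  let 𝒮 : Finset (Finset (Finset (Fin N))) := X.powerset.filter fun S => S.card ≤ ⌊2 * x⌋₊
  let K : List (LGraph ℓ (Fin N)) → LGraph ℓ (Fin N) := fun T =>
    LGraph.ofFamily ℓ (D (T.map LGraph.edges))
  let 𝒜 : Finset (LGraph ℓ (Fin N)) :=
    (Fintype.piFinset fun _ : Fin s => 𝒮).image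
      fun φ => K (List.ofFn fun i => LGraph.ofFamily ℓ (φ i))
  -- A tuple that is no actual fingerprint may decode to an arbitrary graph. Filtering discards such
  -- values and keeps every container arising from an `H`-free graph.
  refine ⟨𝒜.filter fun C => (LGraph.copies H C : ℝ) ≤ ε * (N : ℝ) ^ Fintype.card V ∧
      (C.edges.card : ℝ) ≤ (H.turanDensity + ε) * (N.choose ℓ : ℝ), K, ?_,
    fun C hC => (Finset.mem_filter.1 hC).2, ?_⟩
  · intro I hI
    obtain ⟨T, rfl, hT, hID, hDℓ, hemb⟩ := hD I hI
    have hTℓ : ∀ S ∈ T, (LGraph.ofFamily ℓ S).edges = S := fun S hS =>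
      LGraph.edges_ofFamily fun e he => I.uniform e ((hT S hS).1 he)
    have hmap : (T.map (LGraph.ofFamily ℓ)).map LGraph.edges = T := by
      rw [List.map_map]
      exact (List.map_congr_left hTℓ).trans (List.map_id T)
    have hKe : (K (T.map (LGraph.ofFamily ℓ))).edges = D T := by
      simp only [K, hmap]
      exact LGraph.edges_ofFamily hDℓ
    rw [← hKe] at hemb
    have hNv : (0 : ℝ) ≤ (N : ℝ) ^ Fintype.card V := by positivity
    refine ⟨K (T.map (LGraph.ofFamily ℓ)), Finset.mem_filter.2 ⟨?_, ?_, ?_⟩,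
      hKe ▸ hID, T.map (LGraph.ofFamily ℓ), ?_, ?_, ?_, rfl⟩
    · refine Finset.mem_image.2 ⟨T.get, ?_, ?_⟩
      · rw [Fintype.mem_piFinset]
        intro i
        have hi := hT (T.get i) (List.get_mem T i)
        refine Finset.mem_filter.2 ⟨Finset.mem_powerset.2 fun e he => ?_, Nat.le_floor hi.2⟩
        exact Finset.mem_powersetCard.2 ⟨Finset.subset_univ e, I.uniform e (hi.1 he)⟩
      · congr 1
        conv_rhs => rw [← List.ofFn_get T, List.map_ofFn]
        rfl
    · refine le_trans (Nat.cast_le.2 (LGraph.copies_le_card_embeddings H _)) (hemb.trans ?_)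
      exact mul_le_mul_of_nonneg_right (min_le_right _ _) hNv
    · exact hsuper N (by omega) _
        (hemb.trans (mul_le_mul_of_nonneg_right (min_le_left _ _) hNv))
    · intro S hS
      obtain ⟨S', hS', rfl⟩ := List.mem_map.1 hS
      rw [hTℓ S' hS']
      exact (hT S' hS').1
    · rw [List.length_map]
      have : (0 : ℝ) ≤ T.length * ℓ := by positivity
      have : (0 : ℝ) ≤ T.length := Nat.cast_nonneg _
      linarith
    · have h1 : ((T.map (LGraph.ofFamily ℓ)).map fun S => S.edges.card).sum ≤
          T.length * ⌊2 * x⌋₊ := by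
        refine (List.sum_le_card_nsmul _ ⌊2 * x⌋₊ ?_).trans_eq (by simp)
        intro a ha
        simp only [List.map_map, List.mem_map, Function.comp] at ha
        obtain ⟨S, hS, rfl⟩ := ha
        rw [hTℓ S hS]
        exact Nat.le_floor (hT S hS).2
      have h2 : (⌊2 * x⌋₊ : ℝ) ≤ 2 * x := Nat.floor_le (by positivity)
      calc ((((T.map (LGraph.ofFamily ℓ)).map fun S => S.edges.card).sum : ℕ) : ℝ)
          ≤ T.length * (⌊2 * x⌋₊ : ℝ) := by exact_mod_cast h1
        _ ≤ T.length * (2 * x) := by gcongr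
        _ ≤ T.length * (2 * x) + (2 * T.length * ℓ + 1) * x := by
          have : 0 ≤ (2 * (T.length : ℝ) * ℓ + 1) * x := by positivity
          linarith
        _ = _ := by ring
  · set 𝒞 := 𝒜.filter fun C => (LGraph.copies H C : ℝ) ≤ ε * (N : ℝ) ^ Fintype.card V ∧
      (C.edges.card : ℝ) ≤ (H.turanDensity + ε) * (N.choose ℓ : ℝ)
    have hXcard : X.card + 1 ≤ N ^ (ℓ + 1) := by
      have h1 : X.card ≤ N ^ ℓ := by
        rw [Finset.card_powersetCard, Finset.card_univ, Fintype.card_fin]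
        exact Nat.choose_le_pow N ℓ
      have h2 : 1 ≤ N ^ ℓ := Nat.one_le_pow _ _ (by omega)
      have h3 : N ^ ℓ * 2 ≤ N ^ ℓ * N := Nat.mul_le_mul_left _ (by omega)
      rw [pow_succ]
      omega
    have hcard : 𝒞.card ≤ N ^ ((ℓ + 1) * ⌊2 * x⌋₊ * s) := by
      calc 𝒞.card ≤ 𝒜.card := Finset.card_filter_le _ _
        _ ≤ _ := Finset.card_image_le
        _ = 𝒮.card ^ s := by simp
        _ ≤ ((N ^ (ℓ + 1)) ^ ⌊2 * x⌋₊) ^ s := by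
          refine Nat.pow_le_pow_left ?_ _
          exact (HypergraphContainer.card_filter_powerset_card_le X _).trans
            (Nat.pow_le_pow_left hXcard _)
        _ = _ := by rw [← pow_mul, ← pow_mul, mul_assoc]
    have hlogle : Real.log 𝒞.card ≤ ((ℓ + 1) * ⌊2 * x⌋₊ * s : ℕ) * Real.log N := by
      rcases Nat.eq_zero_or_pos 𝒞.card with h0 | h0
      · rw [h0, Nat.cast_zero, Real.log_zero]
        positivity
      · rw [← Real.log_pow]
        exact Real.log_le_log (by exact_mod_cast h0) (by exact_mod_cast hcard)
    refine hlogle.trans (mul_le_mul_of_nonneg_right ?_ hlog)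
    have h2 : (⌊2 * x⌋₊ : ℝ) ≤ 2 * x := Nat.floor_le (by positivity)
    push_cast
    calc ((ℓ : ℝ) + 1) * ⌊2 * x⌋₊ * s ≤ (ℓ + 1) * (2 * x) * s := by gcongr
      _ ≤ (ℓ + 1) * (2 * x) * s + x := by linarith
      _ = _ := by ring
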